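/- **Setting.** A ribbon graph $G=(V,E)$ is a (finite) surface with boundary presented as a union of vertex discs and edge discs (ribbons), each edge meeting the vertices in exactly two disjoint boundary segments. Write $v(G),e(G),c(G),f(G)$ for its numbers of vertices, edges, components and boundary components, $r(G)=v(G)-c(G)$, $\gamma(G)=2c(G)-v(G)+e(G)-f(G)$ for the Euler genus, and $\rho(G)=\tfrac12(e(G)+v(G)-f(G))$. For $A\subseteq E$, $r(A),\gamma(A),\rho(A)$ refer to the spanning ribbon subgraph $G\backslash A^c$. A vertex partitioned ribbon graph $(G,\mathcal P)$ is a ribbon graph with a partition $\mathcal P$ of $V$. Deletion is $(G,\mathcal P)\backslash e=(G\backslash e,\mathcal P)$; contraction is $(G,\mathcal P)/e=(G/e,\mathcal P')$, where $\mathcal P'$ arises by merging the blocks of the ends $u,v$ of $e$ and replacing $u,v$ in the merged block by the vertices created by the contraction. $G_{/\mathcal P}$ is the graph obtained from the underlying graph of $G$ by identifying the vertices in each block, $r(G_{/\mathcal P})$ is its rank (number of vertices minus number of components), and $r(A_{/\mathcal P})$ is that of its spanning subgraph with edge set $A$. Consider vertex partitioned ribbon graphs up to the equivalence relation generated by isomorphism,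 removal of isolated vertices, and $(G_1,\mathcal P_1)\vee(G_2,\mathcal P_2)\sim(G_1,\mathcal P_1)\sqcup(G_2,\mathcal P_2)$, where in the join $G_1\vee G_2$ a vertex $v_1$ of $G_1$ and a vertex $v_2$ of $G_2$ are united to one vertex $v$ so that the edge ends of $G_1$ at $v$ lie on an arc of the boundary of $v$ that contains no edge end of $G_2$, and the block of $v_1$ and the block of $v_2$ are merged (no other blocks are). Let $K$ be a commutative ring and let $\mathcal H^{vrg}$ be the free $K$-module on the equivalence classes, with the coproduct and the counit $$\Delta(G,\mathcal P)=\sum_{A\subseteq E}(G,\mathcal P)\backslash A^c\otimes(G,\mathcal P)/A,\qquad \varepsilon(G,\mathcal P)=\begin{cases}1&E=\emptyset\\0&\text{otherwise.}\end{cases}$$ It has four basis elements of degree (number of edges) one: $b$, a non-loop edge whose end vertices lie in different blocks; $o$, an orientable loop; $n$, a non-orientable loop; $l$, a non-loop edge whose end vertices lie in the same block. Let $\delta_b,\delta_o,\delta_n,\delta_l:\mathcal H^{vrg}\to K$ be the corresponding coordinate functionals. Let $R$ be a commutative $K$-algebra that is also a $\mathbb Q$-algebra. For $\mathbf a\in R^4$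 the selector is $\delta_{\mathbf a}=a_1\delta_b+a_2\delta_o+a_3\delta_n+a_4\delta_l$. It is uniform if, for each $(G,\mathcal P)$ and each $m\ge 0$, $\delta_{\mathbf a}^{\otimes m}$ takes the same value on all summands of the iterated coproduct $\Delta^{(m-1)}(G,\mathcal P)$ all of whose tensor factors have degree one; these summands correspond to the orderings $e_1,\dots,e_m$ of $E$, with $k$-th tensor factor $(G,\mathcal P)/\{e_1,\dots,e_{k-1}\}\backslash\{e_{k+1},\dots,e_m\}$. With the convolution $f*g=\mathrm{mult}\circ(f\otimes g)\circ\Delta$ and $\exp_*(f)=\sum_{m\ge0}f^{*m}/m!$, put $\alpha(\mathbf a,\mathbf b)=\exp_*(\delta_{\mathbf a})*\exp_*(\delta_{\mathbf b})$. If $\delta_{\mathbf a}$ and $\delta_{\mathbf b}$ are uniform, $\alpha(\mathbf a,\mathbf b)$ is called a canonical Tutte polynomial of $\mathcal H^{vrg}$. **Theorem.** 1. $\delta_{\mathbf a}$ is uniform whenever $a_3^2=a_2a_4$; so all $\alpha(\mathbf a,\mathbf b)$ below are canonical Tutte polynomials. 2. Let $x_1,x_2,x_3,y_1,y_2,y_3$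 be units of $R$ (for example, indeterminates in a ring of Laurent polynomials), where $x_2,x_3,y_2,y_3$ have chosen square roots in $R$, which determine half-integer powers and products such as $\sqrt{x_2x_3}=\sqrt{x_2}\sqrt{x_3}$. For $\mathbf a=(x_1,x_2,\sqrt{x_2x_3},x_3)$, $\mathbf b=(y_1,y_2,\sqrt{y_2y_3},y_3)$ and each vertex partitioned ribbon graph $(G,\mathcal P)$, $$\alpha(\mathbf a,\mathbf b)(G,\mathcal P)=y_1^{r(G_{/\mathcal P})}\,y_2^{|E|-\rho(G)}\,y_3^{\rho(G)-r(G_{/\mathcal P})}\sum_{A\subseteq E}\Big(\frac{x_1}{y_1}\Big)^{r(A_{/\mathcal P})}\Big(\frac{x_2}{y_2}\Big)^{|A|-\rho(A)}\Big(\frac{x_3}{y_3}\Big)^{\rho(A)-r(A_{/\mathcal P})}.$$ 3. Let $R_G(x,y,z)=\sum_{A\subseteq E}(x-1)^{r(G)-r(A)}y^{|A|-r(A)}z^{\gamma(A)}$ be the 3-variable Bollobás–Riordan polynomial, let $G$ be a ribbon graph and $\mathcal P=\{\{v\}\mid v\in V\}$. With $\mathbf a,\mathbf b$ as in 2, $$\alpha(\mathbf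 a,\mathbf b)(G,\mathcal P)=x_1^{r(G)}\,y_2^{|E|-r(G)}\Big(\frac{y_3}{y_2}\Big)^{\frac12\gamma(G)}R_G\Big(\frac{y_1}{x_1}+1,\ \frac{x_2}{y_2},\ \sqrt{\frac{x_3y_2}{x_2y_3}}\Big),$$ and for all $x,y,z\in R$, with $\mathbf a=(1,y,yz,yz^2)$ and $\mathbf b=(x-1,1,1,1)$, $\ \alpha(\mathbf a,\mathbf b)(G,\mathcal P)=R_G(x,y,z)$. -/

import Mathlib

open scoped TensorProduct

/-! ### Ribbon graphs -/

/-- A (finite) ribbon graph, presented by its vertex boundaries.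

The boundary circles of the vertex discs are cut at finitely many *points* into intervals, which
are alternately *arcs* and *segments*: `arc p` and `seg p` are the other endpoints of the arc and of
the segment that meet at `p`. The segments are the places where ribbons may be attached: each edge
`e` is a ribbon that meets the vertex discs in two segments (its two ends, indexed by the first
`Bool`), and `corner e s t` are its four corners: the endpoints of its end `s`, where `t` is the
side of the ribbon, so that `corner e false t` and `corner e true t` are joined by the side `t` of
the ribbon. Distinct ribbon ends lie on distinct segments. A segment that carries no ribbon is just
an interval of the boundary of a vertex (so isolated vertices are circles all of whose segments
carry no ribbon). -/
structure RibbonGraph where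
  /-- the edges -/
  Edge : Type
  /-- the points on the boundaries of the vertices -/
  Pt : Type
  [finite_edge : Finite Edge]
  [finite_pt : Finite Pt]
  arc : Pt → Pt
  arc_arc : ∀ p, arc (arc p) = p
  arc_ne : ∀ p, arc p ≠ p
  seg : Pt → Pt
  seg_seg : ∀ p, seg (seg p) = p
  seg_ne : ∀ p, seg p ≠ p
  corner : Edge → Bool → Bool → Pt
  corner_inj : ∀ {e s t e' s' t'}, corner e s t = corner e' s' t' → e = e' ∧ s = s' ∧ t = t'
  seg_corner : ∀ e s t, seg (corner e s t) = corner e s (!t)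

attribute [instance] RibbonGraph.finite_edge RibbonGraph.finite_pt

noncomputable instance (G : RibbonGraph) : Fintype (Set G.Edge) := Fintype.ofFinite _

/-- The equivalence relation on the vertices of a graph, given by the endpoints of its edges, whose
classes are the connected components. -/
def componentSetoid {V E : Type} (ends : E → Bool → V) : Setoid V :=
  Relation.EqvGen.setoid fun u v => ∃ e, u = ends e false ∧ v = ends e true

/-- The number of connected components of a finite graph. -/
noncomputable def numComponents {V E : Type} (ends : E → Bool → V) : ℕ :=
  Nat.card (Quotient (componentSetoid ends))

/-- The rank of a finite graph: the number of vertices minus the number of components (which is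
never larger). -/
noncomputable def graphRank {V E : Type} (ends : E → Bool → V) : ℕ :=
  Nat.card V - numComponents ends

namespace RibbonGraph

open Classical in
/-- The involution that agrees with `seg`, except that a corner of a ribbon in `A` is sent to the
corner at the opposite end of the same side of that ribbon. -/
noncomputable def turn (G : RibbonGraph) (A : Set G.Edge) (p : G.Pt) : G.Pt :=
  if h : ∃ x : G.Edge × Bool × Bool, x.1 ∈ A ∧ G.corner x.1 x.2.1 x.2.2 = p then
    G.corner h.choose.1 (!h.choose.2.1) h.choose.2.2
  else G.seg p

theorem turn_corner (G : RibbonGraph) {A : Set G.Edge} {e : G.Edge} (he : e ∈ A) (s t : Bool) :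
    G.turn A (G.corner e s t) = G.corner e (!s) t := by
  have h : ∃ x : G.Edge × Bool × Bool, x.1 ∈ A ∧ G.corner x.1 x.2.1 x.2.2 = G.corner e s t :=
    ⟨(e, s, t), he, rfl⟩
  obtain ⟨h1, h2, h3⟩ := G.corner_inj h.choose_spec.2
  rw [turn, dif_pos h, h1, h2, h3]

theorem turn_eq_seg (G : RibbonGraph) {A : Set G.Edge} {p : G.Pt}
    (h : ∀ e ∈ A, ∀ s t, G.corner e s t ≠ p) : G.turn A p = G.seg p := by
  rw [turn, dif_neg]
  rintro ⟨x, hx, hp⟩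
  exact h _ hx _ _ hp

theorem turn_corner_of_notMem (G : RibbonGraph) {A : Set G.Edge} {e : G.Edge} (he : e ∉ A)
    (s t : Bool) : G.turn A (G.corner e s t) = G.corner e s (!t) := by
  rw [turn_eq_seg, G.seg_corner]
  intro e' he' s' t' h
  exact he ((G.corner_inj h).1 ▸ he')

/-- A point is a corner of a ribbon in `A`, or is treated by `turn A` as by `seg`. -/
theorem turn_cases (G : RibbonGraph) (A : Set G.Edge) (p : G.Pt) :
    (∃ e ∈ A, ∃ s t, p = G.corner e s t) ∨
      ((∀ e ∈ A, ∀ s t, G.corner e s t ≠ p) ∧ (∀ e ∈ A, ∀ s t, G.corner e s t ≠ G.seg p)) := by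
  by_cases h : ∃ e ∈ A, ∃ s t, p = G.corner e s t
  · exact Or.inl h
  · refine Or.inr ⟨fun e he s t hp => h ⟨e, he, s, t, hp.symm⟩, fun e he s t hp => ?_⟩
    exact h ⟨e, he, s, !t, by rw [← G.seg_corner, hp, G.seg_seg]⟩

theorem turn_turn (G : RibbonGraph) (A : Set G.Edge) (p : G.Pt) :
    G.turn A (G.turn A p) = p := by
  rcases G.turn_cases A p with ⟨e, he, s, t, rfl⟩ | ⟨h1, h2⟩
  · rw [turn_corner _ he, turn_corner _ he, Bool.not_not]
  · rw [turn_eq_seg _ h1, turn_eq_seg _ h2, G.seg_seg]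

theorem turn_ne (G : RibbonGraph) (A : Set G.Edge) (p : G.Pt) : G.turn A p ≠ p := by
  rcases G.turn_cases A p with ⟨e, he, s, t, rfl⟩ | ⟨h1, -⟩
  · rw [turn_corner _ he]
    intro h
    simpa using (G.corner_inj h).2.1
  · rw [turn_eq_seg _ h1]
    exact G.seg_ne p

/-- Two points are equivalent if they lie on the boundary of the same vertex. -/
def vertexSetoid (G : RibbonGraph) : Setoid G.Pt :=
  Relation.EqvGen.setoid fun p q => q = G.arc p ∨ q = G.seg p

/-- The vertices of `G`: the circles formed by arcs and segments. -/
def Vertex (G : RibbonGraph) : Type := Quotient G.vertexSetoid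

/-- Two points are equivalent if they lie on the same boundary component of the surface `G`: its
boundary runs along arcs, segments without ribbon, and sides of ribbons. -/
noncomputable def boundarySetoid (G : RibbonGraph) : Setoid G.Pt :=
  Relation.EqvGen.setoid fun p q => q = G.arc p ∨ q = G.turn Set.univ p

/-- The end vertices of the edges, that is, the underlying graph of `G`. -/
def ends (G : RibbonGraph) (e : G.Edge) (s : Bool) : G.Vertex :=
  Quotient.mk G.vertexSetoid (G.corner e s false)

/-- The number `|E|` of edges. -/
noncomputable def numEdges (G : RibbonGraph) : ℕ := Nat.card G.Edge

/-- The number `v(G)` of vertices. -/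
noncomputable def numVertices (G : RibbonGraph) : ℕ := Nat.card G.Vertex

/-- The number `f(G)` of boundary components. -/
noncomputable def numBoundary (G : RibbonGraph) : ℕ := Nat.card (Quotient G.boundarySetoid)

/-- The rank `r(G) = v(G) - c(G)`. -/
noncomputable def rank (G : RibbonGraph) : ℕ := graphRank G.ends

/-- The Euler genus `γ(G) = 2c(G) - (v(G) - e(G) + f(G))`: twice the number of components minus the
Euler characteristic of the closed surface obtained by capping off the boundary components. (It is
never negative, so the subtraction does not truncate.) -/
noncomputable def eulerGenus (G : RibbonGraph) : ℕ :=
  (2 * numComponents G.ends + G.numEdges) - (G.numVertices + G.numBoundary)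

/-- `ρ(G) = (|E| + v(G) - f(G)) / 2`. -/
noncomputable def rho (G : RibbonGraph) : ℚ :=
  ((G.numEdges : ℚ) + G.numVertices - G.numBoundary) / 2

/-- Deletion of the edges in `A`: their ribbons are removed. -/
def delete (G : RibbonGraph) (A : Set G.Edge) : RibbonGraph where
  Edge := ↥Aᶜ
  Pt := G.Pt
  arc := G.arc
  arc_arc := G.arc_arc
  arc_ne := G.arc_ne
  seg := G.seg
  seg_seg := G.seg_seg
  seg_ne := G.seg_ne
  corner e := G.corner e
  corner_inj h := by
    obtain ⟨h1, h2⟩ := G.corner_inj h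
    exact ⟨Subtype.ext h1, h2⟩
  seg_corner e := G.seg_corner e

/-- Contraction of the edges in `A`: the vertices incident with `A` and the ribbons in `A` are
replaced by discs that fill the boundary curves of their union. These curves run along the sides of
the ribbons in `A` instead of along the ends of these ribbons. -/
noncomputable def contract (G : RibbonGraph) (A : Set G.Edge) : RibbonGraph where
  Edge := ↥Aᶜ
  Pt := G.Pt
  arc := G.arc
  arc_arc := G.arc_arc
  arc_ne := G.arc_ne
  seg := G.turn A
  seg_seg := G.turn_turn A
  seg_ne := G.turn_ne A
  corner e := G.corner e
  corner_inj h := by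
    obtain ⟨h1, h2⟩ := G.corner_inj h
    exact ⟨Subtype.ext h1, h2⟩
  seg_corner e := G.turn_corner_of_notMem e.2

end RibbonGraph

/-- The 3-variable Bollobás–Riordan polynomial
`R_G(x, y, z) = ∑_{A ⊆ E} (x - 1)^{r(G) - r(A)} y^{|A| - r(A)} z^{γ(A)}`, evaluated at elements of a
commutative ring; `r(A)` and `γ(A)` refer to the spanning ribbon subgraph with edge set `A`. (None
of the subtractions in the exponents truncates.) -/
noncomputable def bollobasRiordan {R : Type*} [CommRing R] (G : RibbonGraph) (x y z : R) : R :=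
  ∑ A : Set G.Edge, (x - 1) ^ (G.rank - (G.delete Aᶜ).rank) * y ^ (A.ncard - (G.delete Aᶜ).rank) *
    z ^ (G.delete Aᶜ).eulerGenus

/-! ### Vertex partitioned ribbon graphs -/

/-- A vertex partitioned ribbon graph. The partition of the vertex set is recorded as the
equivalence relation `block` on the boundary points ("the vertices of `p` and `q` lie in the same
block"), so it has to be coarser than the relation "`p` and `q` lie on the same vertex". -/
structure VPRibbonGraph extends RibbonGraph where
  block : Setoid Pt
  block_arc : ∀ p, block p (arc p)
  block_seg : ∀ p, block p (seg p)

namespace VPRibbonGraph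

/-- The equivalence relation that identifies all corners of each edge in `A`. -/
def edgeSetoid (G : VPRibbonGraph) (A : Set G.Edge) : Setoid G.Pt :=
  Relation.EqvGen.setoid fun p q =>
    ∃ e ∈ A, ∃ s t s' t', p = G.corner e s t ∧ q = G.corner e s' t'

/-- Deletion: the partition is unchanged. -/
def delete (G : VPRibbonGraph) (A : Set G.Edge) : VPRibbonGraph where
  toRibbonGraph := G.toRibbonGraph.delete A
  block := G.block
  block_arc := G.block_arc
  block_seg := G.block_seg

/-- Contraction: for each contracted edge, the blocks of its end vertices are merged, and the
vertices created by the contraction belong to the merged block. -/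
noncomputable def contract (G : VPRibbonGraph) (A : Set G.Edge) : VPRibbonGraph where
  toRibbonGraph := G.toRibbonGraph.contract A
  block := G.block ⊔ G.edgeSetoid A
  block_arc p := (le_sup_left : G.block ≤ G.block ⊔ G.edgeSetoid A) (G.block_arc p)
  block_seg p := by
    change (G.block ⊔ G.edgeSetoid A) p (G.turn A p)
    rcases G.turn_cases A p with ⟨e, he, s, t, rfl⟩ | ⟨h, -⟩
    · rw [G.turn_corner he]
      exact (le_sup_right : G.edgeSetoid A ≤ G.block ⊔ G.edgeSetoid A)
        (Relation.EqvGen.rel _ _ ⟨e, he, s, t, !s, t, rfl, rfl⟩)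
    · rw [G.turn_eq_seg h]
      exact (le_sup_left : G.block ≤ G.block ⊔ G.edgeSetoid A) (G.block_seg p)

/-- The end vertices of the edges in the graph `G_{/𝒫}`, whose vertices are the blocks of the
partition `𝒫`. -/
def blockEnds (G : VPRibbonGraph) (e : G.Edge) (s : Bool) : Quotient G.block :=
  Quotient.mk G.block (G.corner e s false)

/-- The rank `r(G_{/𝒫})`. -/
noncomputable def blockRank (G : VPRibbonGraph) : ℕ := graphRank G.blockEnds

end VPRibbonGraph

/-- The vertex partitioned ribbon graph `(G, {{v} | v ∈ V(G)})`. -/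
def RibbonGraph.discrete (G : RibbonGraph) : VPRibbonGraph where
  toRibbonGraph := G
  block := G.vertexSetoid
  block_arc _ := Relation.EqvGen.rel _ _ (Or.inl rfl)
  block_seg _ := Relation.EqvGen.rel _ _ (Or.inr rfl)

namespace VPRibbonGraph

/-- Isomorphisms of vertex partitioned ribbon graphs. The names `false`, `true` of the ends and of
the sides of each ribbon are immaterial. -/
structure Iso (G H : VPRibbonGraph) where
  edge : G.Edge ≃ H.Edge
  pt : G.Pt ≃ H.Pt
  flipEnd : G.Edge → Bool
  flipSide : G.Edge → Bool
  map_arc : ∀ p, pt (G.arc p) = H.arc (pt p)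
  map_seg : ∀ p, pt (G.seg p) = H.seg (pt p)
  map_corner : ∀ e s t,
    pt (G.corner e s t) = H.corner (edge e) (xor s (flipEnd e)) (xor t (flipSide e))
  map_block : ∀ p q, H.block (pt p) (pt q) ↔ G.block p q

open Classical in
/-- Erasing the segment with endpoints `a` and `seg a`, which carries no ribbon. If `arc a ≠ seg a`,
the two arcs next to it and the segment are united to one arc, and the ribbon graph that is
presented remains the same. If `arc a = seg a`, the segment and the arc form the boundary of an
isolated vertex, which is removed. -/
noncomputable def erase (G : VPRibbonGraph) (a : G.Pt) (ha : ∀ e s t, G.corner e s t ≠ a) :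
    VPRibbonGraph where
  Edge := G.Edge
  Pt := {p : G.Pt // p ≠ a ∧ p ≠ G.seg a}
  arc p := ⟨if G.arc p = a then G.arc (G.seg a) else
      if G.arc p = G.seg a then G.arc a else G.arc p, by
    have h1 := G.arc_arc; have h2 := G.arc_ne; have h3 := G.seg_ne; have := p.2
    grind⟩
  arc_arc p := by
    have h1 := G.arc_arc; have h2 := G.arc_ne; have h3 := G.seg_ne; have := p.2
    apply Subtype.ext
    grind
  arc_ne p := by
    have h1 := G.arc_arc; have h2 := G.arc_ne; have h3 := G.seg_ne; have := p.2
    rw [Ne, Subtype.ext_iff]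
    grind
  seg p := ⟨G.seg p, by
    have h1 := G.seg_seg; have := p.2
    grind⟩
  seg_seg p := Subtype.ext (G.seg_seg p)
  seg_ne p h := G.seg_ne p (congrArg Subtype.val h)
  corner e s t := ⟨G.corner e s t, ha e s t, fun h => ha e s (!t) (by
    rw [← G.seg_corner, h, G.seg_seg])⟩
  corner_inj h := G.corner_inj (congrArg Subtype.val h)
  seg_corner e s t := Subtype.ext (G.seg_corner e s t)
  block := Setoid.comap Subtype.val G.block
  block_arc p := by
    change G.block p _
    have h0 := G.block_arc; have hs := G.block_seg
    dsimp only
    split_ifs with h h'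
    · have k := h0 p
      rw [h] at k
      exact G.block.trans' k (G.block.trans' (hs a) (h0 _))
    · have k := h0 p
      rw [h'] at k
      exact G.block.trans' k (G.block.trans' (G.block.symm' (hs a)) (h0 _))
    · exact h0 p
  block_seg p := G.block_seg p

open Classical in
/-- Joining at an arc: the arc at `p` and the arc at `q` are cut open, and `p` is connected to `q`
and `arc p` to `arc q`. If `p` and `q` lie on different vertices, this unites the two vertices to
one, and the edges at the first one stay together on an arc of the new vertex. The blocks of `p` and
`q` are merged. -/
noncomputable def joinAt (G : VPRibbonGraph) (p q : G.Pt) : VPRibbonGraph where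
  toRibbonGraph :=
    { G.toRibbonGraph with
      arc := fun x => Equiv.swap (G.arc p) q (G.arc (Equiv.swap (G.arc p) q x))
      arc_arc := fun x => by simp [G.arc_arc]
      arc_ne := fun x h => G.arc_ne (Equiv.swap (G.arc p) q x) (by
        have h' := congrArg (Equiv.swap (G.arc p) q) h
        rwa [Equiv.swap_apply_self] at h') }
  block := G.block ⊔ Relation.EqvGen.setoid fun x y => x = p ∧ y = q
  block_arc x := by
    set B := G.block ⊔ Relation.EqvGen.setoid fun x y => x = p ∧ y = q with hB
    have hle : G.block ≤ B := le_sup_left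
    have hpq : B (G.arc p) q := B.trans' (hle (G.block.symm' (G.block_arc p)))
      ((le_sup_right : _ ≤ B) (Relation.EqvGen.rel _ _ ⟨rfl, rfl⟩))
    have hsw : ∀ z, B z (Equiv.swap (G.arc p) q z) := by
      intro z
      rw [Equiv.swap_apply_def]
      split_ifs with h1 h2
      · exact h1 ▸ hpq
      · exact h2 ▸ B.symm' hpq
      · exact B.refl' z
    exact B.trans' (hsw x) (B.trans' (hle (G.block_arc _)) (hsw _))
  block_seg x := (le_sup_left : G.block ≤ _) (G.block_seg x)

/-- `κ` exhibits `G` as the disjoint union of two vertex partitioned ribbon graphs: neither an edge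
nor a block contains points of both colours. -/
def IsSplitting (G : VPRibbonGraph) (κ : G.Pt → Bool) : Prop :=
  (∀ p q, G.block p q → κ p = κ q) ∧
    ∀ e, κ (G.corner e false false) = κ (G.corner e true false)

/-- The elementary identifications: isomorphism, change of presentation and removal of isolated
vertices (both are instances of `erase`), and replacing a join
`(G₁, 𝒫₁) ∨ (G₂, 𝒫₂)` by the disjoint union of `(G₁, 𝒫₁)` and `(G₂, 𝒫₂)`. -/
inductive Step : VPRibbonGraph → VPRibbonGraph → Prop
  | iso {G H : VPRibbonGraph} (φ : Iso G H) : Step G H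
  | erase (G : VPRibbonGraph) (a : G.Pt) (ha : ∀ e s t, G.corner e s t ≠ a) :
      Step G (G.erase a ha)
  | join (G : VPRibbonGraph) (κ : G.Pt → Bool) (hκ : G.IsSplitting κ) (p q : G.Pt)
      (hpq : κ p ≠ κ q) : Step (G.joinAt p q) G

/-- The equivalence relation generated by the elementary identifications. -/
instance setoid : Setoid VPRibbonGraph := Relation.EqvGen.setoid Step

/-! #### Compatibility of the identifications with deletion and contraction -/

theorem Iso.turn {G H : VPRibbonGraph} (φ : Iso G H) (A : Set G.Edge) (p : G.Pt) :
    φ.pt (G.turn A p) = H.turn (φ.edge '' A) (φ.pt p) := by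
  rcases G.turn_cases A p with ⟨e, he, s, t, rfl⟩ | ⟨h, -⟩
  · rw [G.turn_corner he, φ.map_corner, φ.map_corner, H.turn_corner (Set.mem_image_of_mem _ he)]
    simp
  · rw [G.turn_eq_seg h, H.turn_eq_seg, φ.map_seg]
    rintro _ ⟨e, he, rfl⟩ s t hp
    apply h e he (xor s (φ.flipEnd e)) (xor t (φ.flipSide e))
    apply φ.pt.injective
    rw [φ.map_corner, ← hp]
    simp

/-- The equivalence of the remaining edges. -/
def Iso.edgeCompl {G H : VPRibbonGraph} (φ : Iso G H) (A : Set G.Edge) :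
    ↥Aᶜ ≃ ↥(φ.edge '' A)ᶜ :=
  φ.edge.subtypeEquiv (by simp)

/-- Deletion respects isomorphism. -/
def Iso.delete {G H : VPRibbonGraph} (φ : Iso G H) (A : Set G.Edge) :
    Iso (G.delete A) (H.delete (φ.edge '' A)) where
  edge := φ.edgeCompl A
  pt := φ.pt
  flipEnd e := φ.flipEnd e.1
  flipSide e := φ.flipSide e.1
  map_arc := φ.map_arc
  map_seg := φ.map_seg
  map_corner e := φ.map_corner e.1
  map_block := φ.map_block

theorem sup_le_iff_rel {α β : Type} (f : α ≃ β) {r : Setoid α} {r' : Setoid β} {s : α → α → Prop}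
    {s' : β → β → Prop} (h : ∀ p q, r' (f p) (f q) ↔ r p q) (h' : ∀ p q, s' (f p) (f q) ↔ s p q)
    (p q : α) : (r' ⊔ Relation.EqvGen.setoid s') (f p) (f q) ↔
      (r ⊔ Relation.EqvGen.setoid s) p q := by
  constructor
  · have : r' ⊔ Relation.EqvGen.setoid s' ≤
        Setoid.comap f.symm (r ⊔ Relation.EqvGen.setoid s) := by
      refine sup_le (fun x y hxy => ?_) (Setoid.eqvGen_le fun x y hxy => ?_)
      · exact (le_sup_left : r ≤ r ⊔ _) ((h _ _).1 (by simpa using hxy))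
      · exact (le_sup_right : _ ≤ r ⊔ Relation.EqvGen.setoid s)
          (Relation.EqvGen.rel _ _ ((h' _ _).1 (by simpa using hxy)))
    intro hpq
    simpa [Setoid.comap_rel] using this hpq
  · have : r ⊔ Relation.EqvGen.setoid s ≤
        Setoid.comap f (r' ⊔ Relation.EqvGen.setoid s') := by
      refine sup_le (fun x y hxy => ?_) (Setoid.eqvGen_le fun x y hxy => ?_)
      · exact (le_sup_left : r' ≤ r' ⊔ _) ((h _ _).2 hxy)
      · exact (le_sup_right : _ ≤ r' ⊔ Relation.EqvGen.setoid s')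
          (Relation.EqvGen.rel _ _ ((h' _ _).2 hxy))
    exact fun hpq => this hpq

/-- Contraction respects isomorphism. -/
def Iso.contract {G H : VPRibbonGraph} (φ : Iso G H) (A : Set G.Edge) :
    Iso (G.contract A) (H.contract (φ.edge '' A)) where
  edge := φ.edgeCompl A
  pt := φ.pt
  flipEnd e := φ.flipEnd e.1
  flipSide e := φ.flipSide e.1
  map_arc := φ.map_arc
  map_seg := φ.turn A
  map_corner e := φ.map_corner e.1
  map_block := by
    refine sup_le_iff_rel φ.pt φ.map_block fun p q => ?_
    constructor
    · rintro ⟨_, ⟨e, he, rfl⟩, s, t, s', t', hp, hq⟩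
      refine ⟨e, he, xor s (φ.flipEnd e), xor t (φ.flipSide e), xor s' (φ.flipEnd e),
        xor t' (φ.flipSide e), φ.pt.injective ?_, φ.pt.injective ?_⟩
      · rw [hp, φ.map_corner]; simp
      · rw [hq, φ.map_corner]; simp
    · rintro ⟨e, he, s, t, s', t', rfl, rfl⟩
      exact ⟨_, Set.mem_image_of_mem _ he, _, _, _, _, φ.map_corner _ _ _, φ.map_corner _ _ _⟩

/-- An isomorphism that does nothing to the points. -/
def Iso.ofEq {G H : VPRibbonGraph} (edge : G.Edge ≃ H.Edge) (pt : G.Pt ≃ H.Pt)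
    (map_arc : ∀ p, pt (G.arc p) = H.arc (pt p)) (map_seg : ∀ p, pt (G.seg p) = H.seg (pt p))
    (map_corner : ∀ e s t, pt (G.corner e s t) = H.corner (edge e) s t)
    (map_block : ∀ p q, H.block (pt p) (pt q) ↔ G.block p q) : Iso G H where
  edge := edge
  pt := pt
  flipEnd _ := false
  flipSide _ := false
  map_arc := map_arc
  map_seg := map_seg
  map_corner e s t := by simpa using map_corner e s t
  map_block := map_block

theorem equiv_of_step {G H : VPRibbonGraph} (h : Step G H) : G ≈ H := Relation.EqvGen.rel _ _ h

theorem equiv_of_iso {G H : VPRibbonGraph} (φ : Iso G H) : G ≈ H := equiv_of_step (.iso φ)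

theorem erase_block_aux (G : VPRibbonGraph) (a : G.Pt) (ha : ∀ e s t, G.corner e s t ≠ a)
    (A : Set G.Edge) (p q : (G.erase a ha).Pt) :
    (G.block ⊔ G.edgeSetoid A) p.1 q.1 ↔
      ((G.erase a ha).block ⊔ (G.erase a ha).edgeSetoid A) p q := by
  set B := (G.erase a ha).block ⊔ (G.erase a ha).edgeSetoid A with hB
  have hle : (G.erase a ha).block ≤ B := le_sup_left
  have hle' : (G.erase a ha).edgeSetoid A ≤ B := le_sup_right
  constructor
  · let S : Setoid G.Pt :=
      { r := fun x y => G.block x y ∨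
          ∃ x' y' : (G.erase a ha).Pt, G.block x x'.1 ∧ B x' y' ∧ G.block y'.1 y
        iseqv := by
          refine ⟨fun x => Or.inl (G.block.refl' x), ?_, ?_⟩
          · rintro x y (h | ⟨x', y', h1, h2, h3⟩)
            · exact Or.inl (G.block.symm' h)
            · exact Or.inr ⟨y', x', G.block.symm' h3, B.symm' h2, G.block.symm' h1⟩
          · rintro x y z (h | ⟨x', y', h1, h2, h3⟩) (k | ⟨u', v', k1, k2, k3⟩)
            · exact Or.inl (G.block.trans' h k)
            · exact Or.inr ⟨u', v', G.block.trans' h k1, k2, k3⟩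
            · exact Or.inr ⟨x', y', h1, h2, G.block.trans' h3 k⟩
            · have : B y' u' := hle (G.block.trans' h3 k1)
              exact Or.inr ⟨x', v', h1, B.trans' h2 (B.trans' this k2), k3⟩ }
    have hS : G.block ⊔ G.edgeSetoid A ≤ S := by
      refine sup_le (fun x y h => Or.inl h) (Setoid.eqvGen_le ?_)
      rintro x y ⟨e, he, s, t, s', t', rfl, rfl⟩
      refine Or.inr ⟨(G.erase a ha).corner e s t, (G.erase a ha).corner e s' t',
        G.block.refl' _, hle' (Relation.EqvGen.rel _ _ ⟨e, he, s, t, s', t', rfl, rfl⟩),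
        G.block.refl' _⟩
    intro h
    rcases hS h with h | ⟨x', y', h1, h2, h3⟩
    · exact hle h
    · exact B.trans' (hle (x := p) (y := x') h1) (B.trans' h2 (hle (x := y') (y := q) h3))
  · have : B ≤ Setoid.comap Subtype.val (G.block ⊔ G.edgeSetoid A) := by
      refine sup_le (fun x y h => ?_) (Setoid.eqvGen_le ?_)
      · exact (le_sup_left : G.block ≤ G.block ⊔ G.edgeSetoid A) h
      · rintro x y ⟨e, he, s, t, s', t', rfl, rfl⟩
        exact (le_sup_right : G.edgeSetoid A ≤ G.block ⊔ G.edgeSetoid A)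
          (Relation.EqvGen.rel _ _ ⟨e, he, s, t, s', t', rfl, rfl⟩)
    exact fun h => this h

theorem erase_turn (G : VPRibbonGraph) (a : G.Pt) (ha : ∀ e s t, G.corner e s t ≠ a)
    (A : Set G.Edge) (p : (G.erase a ha).Pt) :
    ((G.erase a ha).turn A p).1 = G.turn A p.1 := by
  rcases (G.erase a ha).turn_cases A p with ⟨e, he, s, t, rfl⟩ | ⟨h, -⟩
  · rw [(G.erase a ha).turn_corner he]
    exact (G.turn_corner he s t).symm
  · rw [(G.erase a ha).turn_eq_seg h, G.turn_eq_seg]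
    · rfl
    · exact fun e he s t hp => h e he s t (Subtype.ext hp)

open Classical in
theorem step_minors {G H : VPRibbonGraph} (h : Step G H) : ∃ ε : G.Edge ≃ H.Edge,
    ∀ (A : Set G.Edge) (B : Set H.Edge), B = ε '' A →
      G.delete A ≈ H.delete B ∧ G.contract A ≈ H.contract B := by
  cases h with
  | iso φ =>
    refine ⟨φ.edge, fun A B hB => ?_⟩
    subst hB
    exact ⟨equiv_of_iso (φ.delete A), equiv_of_iso (φ.contract A)⟩
  | erase _ a ha =>
    refine ⟨Equiv.refl _, fun A B hB => ?_⟩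
    obtain rfl : A = B := (hB.trans (Set.image_id A)).symm
    constructor
    · exact equiv_of_step (Step.erase (G.delete A) a fun e => ha e.1)
    · refine Setoid.trans (equiv_of_step (Step.erase (G.contract A) a fun e => ha e.1))
        (equiv_of_iso ?_)
      have hseg : G.turn A a = G.seg a := G.turn_eq_seg fun e _ s t => ha e s t
      have hiff : ∀ x : G.Pt, (x ≠ a ∧ x ≠ G.turn A a) ↔ (x ≠ a ∧ x ≠ G.seg a) := by
        rw [hseg]; exact fun _ => Iff.rfl
      refine Iso.ofEq (Equiv.refl _) (Equiv.subtypeEquivRight hiff) ?_ ?_ ?_ ?_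
      · intro p
        apply Subtype.ext
        change (if G.arc p.1 = a then G.arc (G.turn A a) else
            if G.arc p.1 = G.turn A a then G.arc a else G.arc p.1) =
          (if G.arc p.1 = a then G.arc (G.seg a) else
            if G.arc p.1 = G.seg a then G.arc a else G.arc p.1)
        rw [hseg]
      · intro p
        apply Subtype.ext
        exact (erase_turn G a ha A ((Equiv.subtypeEquivRight hiff) p)).symm
      · intro e s t
        rfl
      · intro p q
        exact (erase_block_aux G a ha A ((Equiv.subtypeEquivRight hiff) p)
          ((Equiv.subtypeEquivRight hiff) q)).symm
  | join _ κ hκ p q hpq =>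
    refine ⟨Equiv.refl _, fun A B hB => ?_⟩
    obtain rfl : A = B := (hB.trans (Set.image_id A)).symm
    constructor
    · exact equiv_of_step (Step.join (H.delete A) κ ⟨hκ.1, fun e => hκ.2 e.1⟩ p q hpq)
    · have hsp : (H.contract A).IsSplitting κ := by
        refine ⟨fun x y hxy => ?_, fun e => hκ.2 e.1⟩
        have hc : ∀ e s t, κ (H.corner e s t) = κ (H.corner e false false) := by
          intro e s t
          have h1 : ∀ s, κ (H.corner e s false) = κ (H.corner e false false) := by
            intro s
            cases s
            · rfl
            · exact (hκ.2 e).symm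
          cases t
          · exact h1 s
          · rw [← h1 s]
            have := hκ.1 _ _ (H.block_seg (H.corner e s false))
            rw [H.seg_corner] at this
            exact this.symm
        have : H.block ⊔ H.edgeSetoid A ≤ Setoid.ker κ := by
          refine sup_le (fun x y h => hκ.1 x y h) (Setoid.eqvGen_le ?_)
          rintro x y ⟨e, -, s, t, s', t', rfl, rfl⟩
          change κ _ = κ _
          rw [hc, hc e s' t']
        exact this hxy
      refine Setoid.trans (equiv_of_iso ?_)
        (equiv_of_step (Step.join (H.contract A) κ hsp p q hpq))
      refine Iso.ofEq (Equiv.refl _) (Equiv.refl _) (fun _ => rfl) (fun _ => rfl)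
        (fun _ _ _ => rfl) (fun x y => ?_)
      have : H.block ⊔ H.edgeSetoid A ⊔ (Relation.EqvGen.setoid fun x y => x = p ∧ y = q) =
        H.block ⊔ (Relation.EqvGen.setoid fun x y => x = p ∧ y = q) ⊔ H.edgeSetoid A :=
        sup_right_comm _ _ _
      exact iff_of_eq (congrArg (fun s : Setoid H.Pt => s x y) this)

/-- The minor obtained by deleting `D` and contracting `C`. -/
noncomputable def minor (G : VPRibbonGraph) (D C : Set G.Edge) : VPRibbonGraph :=
  (G.contract C).delete (Subtype.val ⁻¹' D)

theorem minor_equiv {G K : VPRibbonGraph} {D C : Set G.Edge} (edge : K.Edge ≃ ↥(D ∪ C)ᶜ)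
    (pt : K.Pt ≃ G.Pt) (map_arc : ∀ p, pt (K.arc p) = G.arc (pt p))
    (map_seg : ∀ p, pt (K.seg p) = G.turn C (pt p))
    (map_corner : ∀ e s t, pt (K.corner e s t) = G.corner (edge e) s t)
    (map_block : ∀ p q, (G.block ⊔ G.edgeSetoid C) (pt p) (pt q) ↔ K.block p q) :
    K ≈ G.minor D C := by
  refine equiv_of_iso (Iso.ofEq
    ⟨fun e => ⟨⟨(edge e).1, fun h => (edge e).2 (Or.inr h)⟩, fun h => (edge e).2 (Or.inl h)⟩,
      fun e => edge.symm ⟨e.1.1, fun h => h.elim e.2 e.1.2⟩, fun e => ?_, fun e => ?_⟩ pt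
    map_arc map_seg (fun e s t => map_corner e s t) map_block)
  · simp
  · exact Subtype.ext (Subtype.ext (by simp))

/-- The edges that remain when first `A` and then `B` are removed. -/
def nestEquiv {E : Type} {A : Set E} (B : Set ↥Aᶜ) {X : Set E} (h : X = A ∪ Subtype.val '' B) :
    ↥Bᶜ ≃ ↥Xᶜ where
  toFun e := ⟨e.1.1, by
    rw [h]
    rintro (k | ⟨x, hx, hx'⟩)
    · exact e.1.2 k
    · exact e.2 (Subtype.ext hx' ▸ hx)⟩
  invFun e := ⟨⟨e.1, fun k => e.2 (h.ge (Or.inl k))⟩, fun k => e.2 (h.ge (Or.inr ⟨_, k, rfl⟩))⟩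
  left_inv _ := rfl
  right_inv _ := rfl

theorem edgeSetoid_empty (G : VPRibbonGraph) : G.edgeSetoid ∅ = ⊥ := by
  refine le_antisymm (Setoid.eqvGen_le ?_) bot_le
  rintro x y ⟨e, he, -⟩
  exact he.elim

theorem edgeSetoid_union (G : VPRibbonGraph) (A B : Set G.Edge) :
    G.edgeSetoid (A ∪ B) = G.edgeSetoid A ⊔ G.edgeSetoid B := by
  refine le_antisymm (Setoid.eqvGen_le ?_) (sup_le (Setoid.eqvGen_le ?_) (Setoid.eqvGen_le ?_))
  · rintro x y ⟨e, he | he, h⟩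
    · exact (le_sup_left : _ ≤ G.edgeSetoid A ⊔ G.edgeSetoid B)
        (Relation.EqvGen.rel _ _ ⟨e, he, h⟩)
    · exact (le_sup_right : _ ≤ G.edgeSetoid A ⊔ G.edgeSetoid B)
        (Relation.EqvGen.rel _ _ ⟨e, he, h⟩)
  · rintro x y ⟨e, he, h⟩
    exact Relation.EqvGen.rel _ _ ⟨e, Or.inl he, h⟩
  · rintro x y ⟨e, he, h⟩
    exact Relation.EqvGen.rel _ _ ⟨e, Or.inr he, h⟩

theorem turn_empty (G : VPRibbonGraph) (p : G.Pt) : G.turn ∅ p = G.seg p :=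
  G.turn_eq_seg fun _ he => he.elim

theorem delete_turn (G : VPRibbonGraph) (A : Set G.Edge) (B : Set ↥Aᶜ) (p : G.Pt) :
    (G.delete A).turn B p = G.turn (Subtype.val '' B) p := by
  rcases (G.delete A).turn_cases B p with ⟨e, he, s, t, rfl⟩ | ⟨h, -⟩
  · rw [(G.delete A).turn_corner he]
    exact (G.turn_corner (Set.mem_image_of_mem Subtype.val he) s t).symm
  · rw [(G.delete A).turn_eq_seg h, G.turn_eq_seg]
    · rfl
    · rintro _ ⟨e, he, rfl⟩ s t hp
      exact h e he s t hp

theorem contract_turn (G : VPRibbonGraph) (A : Set G.Edge) (B : Set ↥Aᶜ) (p : G.Pt) :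
    (G.contract A).turn B p = G.turn (A ∪ Subtype.val '' B) p := by
  rcases (G.contract A).turn_cases B p with ⟨e, he, s, t, rfl⟩ | ⟨h, -⟩
  · rw [(G.contract A).turn_corner he]
    exact (G.turn_corner (Or.inr ⟨e, he, rfl⟩) s t).symm
  · rw [(G.contract A).turn_eq_seg h]
    change G.turn A p = _
    rcases G.turn_cases A p with ⟨e, he, s, t, rfl⟩ | ⟨k, -⟩
    · rw [G.turn_corner he, G.turn_corner (Or.inl he)]
    · rw [G.turn_eq_seg k, G.turn_eq_seg]
      rintro e (he | ⟨e, he, rfl⟩) s t hp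
      · exact k e he s t hp
      · exact h e he s t hp

theorem delete_edgeSetoid (G : VPRibbonGraph) (A : Set G.Edge) (B : Set ↥Aᶜ) :
    (G.delete A).edgeSetoid B = G.edgeSetoid (Subtype.val '' B) := by
  refine le_antisymm (Setoid.eqvGen_le ?_) (Setoid.eqvGen_le ?_)
  · rintro x y ⟨e, he, h⟩
    exact Relation.EqvGen.rel _ _ ⟨e.1, ⟨e, he, rfl⟩, h⟩
  · rintro x y ⟨_, ⟨e, he, rfl⟩, h⟩
    exact Relation.EqvGen.rel _ _ ⟨e, he, h⟩

theorem delete_delete (G : VPRibbonGraph) (A : Set G.Edge) (B : Set ↥Aᶜ) {D : Set G.Edge}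
    (hD : D = A ∪ Subtype.val '' B) : (G.delete A).delete B ≈ G.minor D ∅ := by
  refine minor_equiv (nestEquiv B (by rw [hD, Set.union_empty])) (Equiv.refl _) (fun _ => rfl)
    (fun p => (G.turn_empty p).symm) (fun _ _ _ => rfl) (fun p q => ?_)
  rw [edgeSetoid_empty, sup_bot_eq]
  exact Iff.rfl

theorem delete_contract (G : VPRibbonGraph) (A : Set G.Edge) (B : Set ↥Aᶜ) {D C : Set G.Edge}
    (hD : D = A) (hC : C = Subtype.val '' B) : (G.delete A).contract B ≈ G.minor D C := by
  subst hD hC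
  refine minor_equiv (nestEquiv B rfl) (Equiv.refl _) (fun _ => rfl)
    (fun p => G.delete_turn D B p) (fun _ _ _ => rfl) (fun p q => ?_)
  rw [← delete_edgeSetoid]
  exact Iff.rfl

theorem contract_delete (G : VPRibbonGraph) (A : Set G.Edge) (B : Set ↥Aᶜ) {D C : Set G.Edge}
    (hD : D = Subtype.val '' B) (hC : C = A) : (G.contract A).delete B ≈ G.minor D C := by
  subst hD hC
  exact minor_equiv (nestEquiv B (Set.union_comm _ _)) (Equiv.refl _) (fun _ => rfl)
    (fun _ => rfl) (fun _ _ _ => rfl) (fun _ _ => Iff.rfl)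

theorem contract_contract (G : VPRibbonGraph) (A : Set G.Edge) (B : Set ↥Aᶜ) {C : Set G.Edge}
    (hC : C = A ∪ Subtype.val '' B) : (G.contract A).contract B ≈ G.minor ∅ C := by
  subst hC
  refine minor_equiv (nestEquiv B (Set.empty_union _)) (Equiv.refl _) (fun _ => rfl)
    (fun p => G.contract_turn A B p) (fun _ _ _ => rfl) (fun p q => ?_)
  rw [edgeSetoid_union, ← sup_assoc, ← delete_edgeSetoid]
  exact Iff.rfl

theorem delete_equiv (G : VPRibbonGraph) (A : Set G.Edge) : G.delete A ≈ G.minor A ∅ := by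
  refine minor_equiv (Equiv.setCongr (by rw [Set.union_empty])) (Equiv.refl _) (fun _ => rfl)
    (fun p => (G.turn_empty p).symm) (fun _ _ _ => rfl) (fun p q => ?_)
  rw [edgeSetoid_empty, sup_bot_eq]
  exact Iff.rfl

theorem contract_equiv (G : VPRibbonGraph) (A : Set G.Edge) : G.contract A ≈ G.minor ∅ A :=
  minor_equiv (Equiv.setCongr (by rw [Set.empty_union])) (Equiv.refl _) (fun _ => rfl)
    (fun _ => rfl) (fun _ _ _ => rfl) (fun _ _ => Iff.rfl)

theorem equiv_minor (G : VPRibbonGraph) : G ≈ G.minor ∅ ∅ := by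
  refine minor_equiv ((Equiv.Set.univ G.Edge).symm.trans (Equiv.setCongr (by simp)))
    (Equiv.refl _) (fun _ => rfl)
    (fun p => (G.turn_empty p).symm) (fun _ _ _ => rfl) (fun p q => ?_)
  rw [edgeSetoid_empty, sup_bot_eq]
  exact Iff.rfl

theorem card_edge_eq {G H : VPRibbonGraph} (h : G ≈ H) : Nat.card G.Edge = Nat.card H.Edge := by
  induction h with
  | rel _ _ h => exact Nat.card_congr (step_minors h).choose
  | refl _ => rfl
  | symm _ _ _ ih => exact ih.symm
  | trans _ _ _ _ _ ih₁ ih₂ => exact ih₁.trans ih₂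

/-- The vertex partitioned ribbon graph with one edge whose four corners are the only points. -/
def oneEdge (arc : Bool × Bool → Bool × Bool) (h1 : ∀ p, arc (arc p) = p) (h2 : ∀ p, arc p ≠ p)
    (block : Setoid (Bool × Bool)) (h3 : ∀ p, block p (arc p))
    (h4 : ∀ p, block p (p.1, !p.2)) : VPRibbonGraph where
  Edge := Unit
  Pt := Bool × Bool
  arc := arc
  arc_arc := h1
  arc_ne := h2
  seg p := (p.1, !p.2)
  seg_seg _ := by simp
  seg_ne p h := by simpa using congrArg Prod.snd h
  corner _ s t := (s, t)
  corner_inj h := by simpa using h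
  seg_corner _ _ _ := rfl
  block := block
  block_arc := h3
  block_seg := h4

/-- A non-loop edge whose end vertices `u`, `v` lie in different blocks: `𝒫 = {{u}, {v}}`. -/
def bridge : VPRibbonGraph :=
  oneEdge (fun p => (p.1, !p.2)) (by decide) (by decide) (Setoid.ker Prod.fst)
    (fun _ => rfl) (fun _ => rfl)

/-- An orientable (untwisted) loop: an annulus. -/
def orientableLoop : VPRibbonGraph :=
  oneEdge (fun p => (!p.1, p.2)) (by decide) (by decide) ⊤ (fun _ => trivial) (fun _ => trivial)

/-- A non-orientable (half-twisted) loop: a Möbius band. -/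
def nonorientableLoop : VPRibbonGraph :=
  oneEdge (fun p => (!p.1, !p.2)) (by decide) (by decide) ⊤ (fun _ => trivial) (fun _ => trivial)

/-- A non-loop edge whose end vertices `u`, `v` lie in the same block: `𝒫 = {{u, v}}`. -/
def linkedEdge : VPRibbonGraph :=
  oneEdge (fun p => (p.1, !p.2)) (by decide) (by decide) ⊤ (fun _ => trivial) (fun _ => trivial)

end VPRibbonGraph

/-! ### The Hopf algebra and its Tutte polynomial -/

/-- Equivalence classes of vertex partitioned ribbon graphs, up to isomorphism, joins and isolated
vertices. -/
def VRClass : Type 1 := Quotient VPRibbonGraph.setoid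

/-- The class of `(G, 𝒫)`. -/
def VPRibbonGraph.cls (G : VPRibbonGraph) : VRClass := Quotient.mk _ G

theorem VPRibbonGraph.cls_eq {G H : VPRibbonGraph} (h : G ≈ H) : G.cls = H.cls := Quotient.sound h

/-- The degree of a class: the number of edges. -/
noncomputable def VRClass.degree : VRClass → ℕ :=
  Quotient.lift (fun G : VPRibbonGraph => Nat.card G.Edge) fun _ _ h =>
    VPRibbonGraph.card_edge_eq h

/-- The underlying module of `ℋ^{vrg}`: formal `K`-linear combinations of classes. -/
def Hvrg (K : Type*) [CommRing K] := VRClass →₀ K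

namespace Hvrg

variable (K : Type*) [CommRing K]

noncomputable instance : AddCommGroup (Hvrg K) := inferInstanceAs (AddCommGroup (VRClass →₀ K))

noncomputable instance : Module K (Hvrg K) := inferInstanceAs (Module K (VRClass →₀ K))

/-- The basis of `ℋ^{vrg}` that consists of the classes. -/
noncomputable def basis : Module.Basis VRClass K (Hvrg K) := Finsupp.basisSingleOne

/-- The basis element of the class of `(G, 𝒫)`. -/
noncomputable def of (G : VPRibbonGraph) : Hvrg K := basis K G.cls

theorem of_eq {G H : VPRibbonGraph} (h : G ≈ H) : of K G = of K H :=
  congrArg (basis K) (VPRibbonGraph.cls_eq h)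

/-- `∑_{A ⊆ E} (G, 𝒫) \ Aᶜ ⊗ (G, 𝒫) / A`. -/
noncomputable def coprod (G : VPRibbonGraph) : Hvrg K ⊗[K] Hvrg K :=
  ∑ A : Set G.Edge, of K (G.delete Aᶜ) ⊗ₜ[K] of K (G.contract A)

theorem coprod_eq {G H : VPRibbonGraph} (h : G ≈ H) : coprod K G = coprod K H := by
  induction h with
  | rel G H h =>
    obtain ⟨ε, hε⟩ := VPRibbonGraph.step_minors h
    refine Fintype.sum_equiv (Equiv.Set.congr ε) _ _ fun A => ?_
    have h1 : (Equiv.Set.congr ε A)ᶜ = ε '' Aᶜ := (Set.image_compl_eq ε.bijective).symm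
    rw [of_eq K (hε Aᶜ _ h1).1, of_eq K (hε A (Equiv.Set.congr ε A) rfl).2]
  | refl _ => rfl
  | symm _ _ _ ih => exact ih.symm
  | trans _ _ _ _ _ ih₁ ih₂ => exact ih₁.trans ih₂

/-- The coproduct and the counit (`1` on classes of degree `0`, and `0` on other classes). -/
noncomputable instance : CoalgebraStruct K (Hvrg K) where
  comul := (basis K).constr K (Quotient.lift (coprod K) fun _ _ h => coprod_eq K h)
  counit := (basis K).constr K fun S => if S.degree = 0 then 1 else 0

theorem comul_of (G : VPRibbonGraph) : Coalgebra.comul (R := K) (of K G) = coprod K G :=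
  (basis K).constr_basis K _ _

theorem counit_of (G : VPRibbonGraph) :
    Coalgebra.counit (R := K) (of K G) = if Nat.card G.Edge = 0 then 1 else 0 :=
  (basis K).constr_basis K _ _

theorem hom_ext {M : Type*} [AddCommMonoid M] [Module K M] {f g : Hvrg K →ₗ[K] M}
    (h : ∀ G : VPRibbonGraph, f (of K G) = g (of K G)) : f = g :=
  (basis K).ext fun S => Quotient.inductionOn S h

open Classical in
theorem coassoc_aux {E M : Type*} [Finite E] [AddCommMonoid M] [Fintype (Set E)]
    (T : Set E → Set E → M) [inst : ∀ A : Set E, Fintype (Set ↥(Aᶜ))] :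
    ∑ A : Set E, ∑ B : Set ↥(Aᶜᶜ), T (Subtype.val '' B) A =
      ∑ A : Set E, ∑ B : Set ↥(Aᶜ), T A (A ∪ Subtype.val '' B) := by
  have h1 : ∀ A : Set E, ∑ B : Set ↥(Aᶜᶜ), T (Subtype.val '' B) A =
      ∑ X : Set E, if X ⊆ A then T X A else 0 := by
    intro A
    rw [← Finset.sum_filter]
    refine Finset.sum_nbij' (fun B => Subtype.val '' B) (fun X => Subtype.val ⁻¹' X) ?_ ?_ ?_ ?_ ?_
    · intro B _
      simp only [Finset.mem_filter, Finset.mem_univ, true_and]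
      rintro _ ⟨x, -, rfl⟩
      exact not_not.1 x.2
    · simp
    · intro B _
      exact Set.preimage_image_eq _ Subtype.val_injective
    · intro X hX
      simp only [Finset.mem_filter, Finset.mem_univ, true_and] at hX
      simpa [Subtype.image_preimage_coe] using hX
    · simp
  have h2 : ∀ A : Set E, ∑ B : Set ↥(Aᶜ), T A (A ∪ Subtype.val '' B) =
      ∑ Y : Set E, if A ⊆ Y then T A Y else 0 := by
    intro A
    rw [← Finset.sum_filter]
    refine Finset.sum_nbij' (fun B => A ∪ Subtype.val '' B) (fun X => Subtype.val ⁻¹' X)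
      ?_ ?_ ?_ ?_ ?_
    · simp
    · simp
    · intro B _
      ext x
      have := x.2
      simp_all
    · intro Y hY
      simp only [Finset.mem_filter, Finset.mem_univ, true_and] at hY
      rw [Subtype.image_preimage_coe]
      ext x
      have := @hY x
      by_cases hx : x ∈ A <;> simp_all
    · simp
  simp_rw [h1, h2]
  exact Finset.sum_comm

theorem compl_nest {E : Type*} {A : Set E} (B : Set ↥(Aᶜ)) :
    (A ∪ Subtype.val '' B)ᶜ = Subtype.val '' Bᶜ := by
  ext x
  by_cases hx : x ∈ A <;> simp [hx]

noncomputable instance : Coalgebra K (Hvrg K) where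
  coassoc := by
    refine hom_ext K fun G => ?_
    simp only [LinearMap.comp_apply, comul_of, coprod, map_sum, LinearMap.rTensor_tmul,
      LinearMap.lTensor_tmul, TensorProduct.sum_tmul, TensorProduct.tmul_sum,
      LinearEquiv.coe_coe, TensorProduct.assoc_tmul]
    let inst : ∀ A : Set G.Edge, Fintype (Set ↥(Aᶜ)) := fun A =>
      inferInstanceAs (Fintype (Set (G.delete A).Edge))
    let T : Set G.Edge → Set G.Edge → Hvrg K ⊗[K] (Hvrg K ⊗[K] Hvrg K) := fun X Y =>
      of K (G.minor Xᶜ ∅) ⊗ₜ (of K (G.minor Yᶜ X) ⊗ₜ of K (G.minor ∅ Y))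
    have h1 : ∀ (A : Set G.Edge) (B : Set ↥(Aᶜᶜ)), of K ((G.delete Aᶜ).delete Bᶜ) ⊗ₜ[K]
        (of K ((G.delete Aᶜ).contract B) ⊗ₜ[K] of K (G.contract A)) = T (Subtype.val '' B) A := by
      intro A B
      have hD : (Subtype.val '' B)ᶜ = Aᶜ ∪ Subtype.val '' Bᶜ := by
        ext x
        by_cases hx : x ∈ A <;> simp [hx]
      exact congrArg₂ (TensorProduct.tmul K) (of_eq K (G.delete_delete Aᶜ Bᶜ hD))
        (congrArg₂ (TensorProduct.tmul K) (of_eq K (G.delete_contract Aᶜ B rfl rfl))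
          (of_eq K (G.contract_equiv A)))
    have h2 : ∀ (A : Set G.Edge) (B : Set ↥(Aᶜ)), of K (G.delete Aᶜ) ⊗ₜ[K]
        (of K ((G.contract A).delete Bᶜ) ⊗ₜ[K] of K ((G.contract A).contract B)) =
          T A (A ∪ Subtype.val '' B) := by
      intro A B
      exact congrArg₂ (TensorProduct.tmul K) (of_eq K (G.delete_equiv Aᶜ))
        (congrArg₂ (TensorProduct.tmul K) (of_eq K (G.contract_delete A Bᶜ (compl_nest B) rfl))
          (of_eq K (G.contract_contract A B rfl)))
    exact (Finset.sum_congr rfl fun A _ => Finset.sum_congr rfl fun B _ => h1 A B).trans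
      ((coassoc_aux (inst := inst) T).trans
        (Finset.sum_congr rfl fun A _ => Finset.sum_congr rfl fun B _ => h2 A B).symm)
  rTensor_counit_comp_comul := by
    refine hom_ext K fun G => ?_
    simp only [LinearMap.comp_apply, comul_of, coprod, map_sum, LinearMap.rTensor_tmul, counit_of]
    rw [Finset.sum_eq_single (∅ : Set G.Edge)]
    · have h : Nat.card (G.delete ∅ᶜ).Edge = 0 := by
        have : IsEmpty (G.delete ∅ᶜ).Edge := ⟨fun e => e.2 (Set.mem_compl fun h => h)⟩
        exact Nat.card_of_isEmpty
      rw [if_pos h, of_eq K (G.contract_equiv ∅), of_eq K G.equiv_minor]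
      rfl
    · intro A _ hA
      obtain ⟨e, he⟩ := Set.nonempty_iff_ne_empty.2 hA
      have : Nonempty (G.delete Aᶜ).Edge := ⟨⟨e, fun h => h he⟩⟩
      have : Finite (G.delete Aᶜ).Edge := (G.delete Aᶜ).finite_edge
      rw [if_neg Nat.card_pos.ne', TensorProduct.zero_tmul]
    · simp
  lTensor_counit_comp_comul := by
    refine hom_ext K fun G => ?_
    simp only [LinearMap.comp_apply, comul_of, coprod, map_sum, LinearMap.lTensor_tmul, counit_of]
    rw [Finset.sum_eq_single (Set.univ : Set G.Edge)]
    · have h : Nat.card (G.contract Set.univ).Edge = 0 := by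
        have : IsEmpty (G.contract Set.univ).Edge := ⟨fun e => e.2 trivial⟩
        exact Nat.card_of_isEmpty
      rw [if_pos h, of_eq K (G.delete_equiv _), Set.compl_univ, of_eq K G.equiv_minor]
      rfl
    · intro A _ hA
      obtain ⟨e, he⟩ := (Set.ne_univ_iff_exists_notMem A).1 hA
      have : Nonempty (G.contract A).Edge := ⟨⟨e, he⟩⟩
      have : Finite (G.contract A).Edge := (G.contract A).finite_edge
      rw [if_neg Nat.card_pos.ne', TensorProduct.tmul_zero]
    · simp

section Tutte

variable {K : Type*} [CommRing K] {R : Type*} [CommRing R] [Algebra K R]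

/-- The four classes of degree one: `b`, `o`, `n`, `l`. -/
def gen : Fin 4 → VRClass :=
  ![VPRibbonGraph.bridge.cls, VPRibbonGraph.orientableLoop.cls,
    VPRibbonGraph.nonorientableLoop.cls, VPRibbonGraph.linkedEdge.cls]

/-- The linear extension `δ_i` of the indicator function of the `i`-th class of degree one. -/
noncomputable def indicator (i : Fin 4) : Hvrg K →ₗ[K] K := (basis K).coord (gen i)

/-- The selector `δ_𝐚 = a₁ δ_b + a₂ δ_o + a₃ δ_n + a₄ δ_l`. -/
noncomputable def selector (a : Fin 4 → R) : Hvrg K →ₗ[K] R :=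
  ∑ i, (indicator i).smulRight (a i)

/-- The `∗`-exponential `∑_{m ≥ 0} f^{∗m} / m!`, where powers are taken with respect to convolution.
The sum is evaluated class by class (for a selector `f`, only finitely many terms are nonzero at
each class). -/
noncomputable def convExp [Algebra ℚ R] (f : Hvrg K →ₗ[K] R) : Hvrg K →ₗ[K] R :=
  (basis K).constr K fun S =>
    ∑ᶠ m : ℕ, (1 / (m.factorial : ℚ)) • (WithConv.toConv f ^ m).ofConv (basis K S)

/-- The Tutte polynomial `α(𝐚, 𝐛) = exp_∗(δ_𝐚) ∗ exp_∗(δ_𝐛)`. -/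
noncomputable def tutte [Algebra ℚ R] (a b : Fin 4 → R) : Hvrg K →ₗ[K] R :=
  (WithConv.toConv (convExp (selector a)) * WithConv.toConv (convExp (selector b))).ofConv

/-- For an ordering `σ` of the edges `e₀, …, e_{m-1}` of `(G, 𝒫)`, the `k`-th tensor factor of the
corresponding summand of the `(m-1)`-fold iterated coproduct of `(G, 𝒫)`: the edges before `e_k` are
contracted, and the edges after `e_k` are deleted. -/
noncomputable def factor (G : VPRibbonGraph) {m : ℕ} (σ : G.Edge ≃ Fin m) (k : Fin m) :
    VPRibbonGraph :=
  (G.contract {e | σ e < k}).delete {e | k < σ e.1}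

/-- A functional (meant to be a selector) is uniform if, for each `(G, 𝒫)` and each `m`, its tensor
power takes the same value on all summands of the `(m-1)`-fold iterated coproduct of `(G, 𝒫)` all of
whose tensor factors have degree one. -/
def IsUniform (f : Hvrg K →ₗ[K] R) : Prop :=
  ∀ (G : VPRibbonGraph) (m : ℕ) (σ τ : G.Edge ≃ Fin m),
    ∏ k, f (of K (factor G σ k)) = ∏ k, f (of K (factor G τ k))

end Tutte

end Hvrg

/-- The power `x ^ q` of `x = s ^ 2` for a half-integer `q`, where `s` is the chosen square root of
`x`: it is `s ^ (2q)`. -/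
def halfPow {R : Type*} [CommRing R] (s : Rˣ) (q : ℚ) : Rˣ := s ^ (2 * q).num

/-! ### Counting classes of equivalence relations -/

/-! Everything rests on two counting functions on edge sets: `circ A`, the number of boundary curves
of the vertices together with the ribbons in `A`, and `blk A`, the number of blocks after merging
along `A`. Minors keep all points, so the same numbers for a minor are values of the two functions
of `G`: deletion restricts to subsets of the remaining edges, and contraction of `C` replaces `A` by
`C ∪ A`. Hence the drops from the empty set to the full edge set, `circDrop` and `blkDrop`,
telescope along any chain of minors. So do the number of edges and the integer combinations
`blockRank`, `nullity` and `excess`, the last being twice `ρ(G) - r(G_{/𝒫})`.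

If `a 2 ^ 2 = a 1 * a 3`, these exponents define a monomial weight that is multiplicative: the
weights of `G \ Aᶜ` and `G / A` multiply to that of `G` (`monomialWeight_mul`,
`VPRibbonGraph.weight_mul`). On degree one the weight is the selector (`selector_of`). This needs
the classification of one-edge graphs up to equivalence and the invariance of the drops, which also
separates the four classes. The product of the selector along any ordering of the edges is therefore
the weight of `G`, which is uniformity. In degree `m` there are `m!` orderings, so the `m`-th
convolution power is `m!` times the weight, and the `∗`-exponential of the selector is the weight
itself (`convExp_selector`).

Consequently `α(𝐚, 𝐛)` is the sum over `A` of the `𝐚`-weight of `G \ Aᶜ` times the `𝐛`-weight of `G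
/ A`, and the stated formulas follow term by term by comparing exponents. For the partition into
singletons, `excess` is the Euler genus, which brings in the Bollobás–Riordan polynomial. -/

theorem card_quotient_eq {α β : Type*} {S : Setoid α} (f : α → β) (hf : Function.Surjective f)
    (h : ∀ x y, S x y ↔ f x = f y) : Nat.card (Quotient S) = Nat.card β := by
  refine Nat.card_congr (Equiv.ofBijective (Quotient.lift f fun x y hxy => (h x y).1 hxy) ⟨?_, ?_⟩)
  · intro x y
    induction x using Quotient.inductionOn
    induction y using Quotient.inductionOn
    exact fun hxy => Quotient.sound ((h _ _).2 hxy)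
  · intro y
    obtain ⟨x, rfl⟩ := hf y
    exact ⟨Quotient.mk _ x, rfl⟩

open Classical in
-- The points outside `T` all lie in the class of `a`, so restricting to `T` can lose only that
-- class, and loses it exactly when it contains no point of `T`. For erasing a segment, the points
-- outside `T` are its two endpoints.
theorem card_quotient_comap_val {α : Type*} [Finite α] (S : Setoid α) (T : α → Prop) (a : α)
    (ha : ∀ x, ¬ T x → S x a) (haT : ¬ T a) :
    Nat.card (Quotient S) = Nat.card (Quotient (S.comap (Subtype.val : {x // T x} → α))) +
      if ∃ t, T t ∧ S t a then 0 else 1 := by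
  set S' := S.comap (Subtype.val : {x // T x} → α) with hS'
  have hS (x y : {x // T x}) : Quotient.mk S' x = Quotient.mk S' y ↔ S x.1 y.1 := Quotient.eq
  split_ifs with h
  · obtain ⟨t, ht, hta⟩ := h
    rw [add_zero]
    refine card_quotient_eq (fun x => if hx : T x then Quotient.mk S' ⟨x, hx⟩ else
      Quotient.mk S' ⟨t, ht⟩) ?_ ?_
    · intro y
      induction y using Quotient.inductionOn with | h y => exact ⟨y.1, by simp [y.2]⟩
    · intro x y
      split_ifs with hx hy hy
      · exact (hS ⟨x, hx⟩ ⟨y, hy⟩).symm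
      · rw [hS]
        exact ⟨fun k => S.trans' k (S.trans' (ha y hy) (S.symm' hta)),
          fun k => S.trans' k (S.trans' hta (S.symm' (ha y hy)))⟩
      · rw [hS]
        exact ⟨fun k => S.trans' hta (S.trans' (S.symm' (ha x hx)) k),
          fun k => S.trans' (ha x hx) (S.trans' (S.symm' hta) k)⟩
      · exact iff_of_true (S.trans' (ha x hx) (S.symm' (ha y hy))) rfl
  · rw [← Finite.card_option]
    refine card_quotient_eq (fun x => if hx : T x then some (Quotient.mk S' ⟨x, hx⟩) else none)
      ?_ ?_
    · rintro (_ | y)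
      · exact ⟨a, by simp [haT]⟩
      · induction y using Quotient.inductionOn with | h y => exact ⟨y.1, by simp [y.2]⟩
    · intro x y
      split_ifs with hx hy hy
      · rw [Option.some_inj, hS]
      · exact iff_of_false (fun k => h ⟨x, hx, S.trans' k (ha y hy)⟩) (by simp)
      · exact iff_of_false (fun k => h ⟨y, hy, S.trans' (S.symm' k) (ha x hx)⟩) (by simp)
      · exact iff_of_true (S.trans' (ha x hx) (S.symm' (ha y hy))) rfl

open Classical in
theorem card_quotient_sup_pair {α : Type*} [Finite α] (S : Setoid α) {p q : α} (hpq : ¬ S p q) :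
    Nat.card (Quotient S) =
      Nat.card (Quotient (S ⊔ Relation.EqvGen.setoid fun x y => x = p ∧ y = q)) + 1 := by
  set S' := S ⊔ Relation.EqvGen.setoid fun x y => x = p ∧ y = q with hS'
  have hS (x y : α) : Quotient.mk S' x = Quotient.mk S' y ↔ S' x y := Quotient.eq
  have hle : S ≤ S' := le_sup_left
  have hp : S' p q := (le_sup_right : _ ≤ S') (Relation.EqvGen.rel _ _ ⟨rfl, rfl⟩)
  -- An explicit description of the merged relation, needed to recover `S` from `S'` away from the
  -- classes of `p` and `q`.
  let R : Setoid α :=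
    { r := fun x y => S x y ∨ ((S x p ∨ S x q) ∧ (S y p ∨ S y q))
      iseqv := by
        refine ⟨fun x => Or.inl (S.refl' x), ?_, ?_⟩
        · rintro x y (h | ⟨h1, h2⟩)
          exacts [Or.inl (S.symm' h), Or.inr ⟨h2, h1⟩]
        · rintro x y z (h | ⟨h1, h2⟩) (k | ⟨k1, k2⟩)
          · exact Or.inl (S.trans' h k)
          · exact Or.inr ⟨k1.imp (S.trans' h) (S.trans' h), k2⟩
          · exact Or.inr ⟨h1, h2.imp (S.trans' (S.symm' k)) (S.trans' (S.symm' k))⟩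
          · exact Or.inr ⟨h1, k2⟩ }
  have hR : S' ≤ R := by
    refine sup_le (fun x y h => Or.inl h) (Setoid.eqvGen_le ?_)
    rintro x y ⟨rfl, rfl⟩
    exact Or.inr ⟨Or.inl (S.refl' _), Or.inr (S.refl' _)⟩
  rw [← Finite.card_option]
  -- The class of `p` becomes the extra element `none`; the merged class is then represented by `q`
  -- alone.
  refine card_quotient_eq (fun x => if S x p then none else some (Quotient.mk S' x)) ?_ ?_
  · rintro (_ | y)
    · exact ⟨p, by simp⟩
    · induction y using Quotient.inductionOn with | h y =>
      by_cases hy : S y p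
      · refine ⟨q, ?_⟩
        refine (if_neg fun h => hpq (S.symm' h)).trans (congrArg _ ((hS _ _).2 ?_))
        exact S'.symm' (S'.trans' (hle hy) hp)
      · exact ⟨y, by simp [hy]⟩
  · intro x y
    split_ifs with hx hy hy
    · exact iff_of_true (S.trans' hx (S.symm' hy)) rfl
    · exact iff_of_false (fun h => hy (S.trans' (S.symm' h) hx)) (by simp)
    · exact iff_of_false (fun h => hx (S.trans' h hy)) (by simp)
    · rw [Option.some_inj, hS]
      refine ⟨fun h => hle h, fun h => ?_⟩
      rcases hR h with h | ⟨h1, h2⟩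
      · exact h
      · exact S.trans' (h1.resolve_left hx) (S.symm' (h2.resolve_left hy))

/-- Modulo 2, the terms of a sum of ones cancel in pairs. This parity is the combinatorial
substitute for the fact that the boundary curves are circles. -/
theorem Finset.even_card_of_involution {α : Type*} (s : Finset α) (f : α → α)
    (hs : ∀ x ∈ s, f x ∈ s) (hf : ∀ x ∈ s, f (f x) = x) (hne : ∀ x ∈ s, f x ≠ x) :
    Even s.card := by
  have h : ∑ _x ∈ s, (1 : ZMod 2) = 0 :=
    Finset.sum_involution (fun x _ => f x) (fun _ _ => by decide) (fun x hx _ => hne x hx)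
      hs hf
  rw [← ZMod.natCast_eq_zero_iff_even]
  simpa using h

/-! ### Circles and blocks relative to a set of edges -/

namespace RibbonGraph

/-- Two points are equivalent if they lie on the same boundary curve of the union of the vertices
and the ribbons in `A`. -/
noncomputable def circSetoid (G : RibbonGraph) (A : Set G.Edge) : Setoid G.Pt :=
  Relation.EqvGen.setoid fun p q => q = G.arc p ∨ q = G.turn A p

/-- The number of boundary curves of the union of the vertices and the ribbons in `A`. -/
noncomputable def circ (G : RibbonGraph) (A : Set G.Edge) : ℕ := Nat.card (Quotient (G.circSetoid A))

theorem circSetoid_arc (G : RibbonGraph) (A : Set G.Edge) (p : G.Pt) :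
    G.circSetoid A p (G.arc p) := Relation.EqvGen.rel _ _ (Or.inl rfl)

theorem circSetoid_turn (G : RibbonGraph) (A : Set G.Edge) (p : G.Pt) :
    G.circSetoid A p (G.turn A p) := Relation.EqvGen.rel _ _ (Or.inr rfl)

theorem circSetoid_le {G : RibbonGraph} {A : Set G.Edge} {S : Setoid G.Pt}
    (h1 : ∀ p, S p (G.arc p)) (h2 : ∀ p, S p (G.turn A p)) : G.circSetoid A ≤ S := by
  refine Setoid.eqvGen_le ?_
  rintro x y (rfl | rfl)
  exacts [h1 x, h2 x]

theorem turn_empty' (G : RibbonGraph) (p : G.Pt) : G.turn ∅ p = G.seg p :=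
  G.turn_eq_seg fun _ he => he.elim

theorem circSetoid_empty (G : RibbonGraph) : G.circSetoid ∅ = G.vertexSetoid := by
  simp only [circSetoid, vertexSetoid, turn_empty']

theorem numVertices_eq (G : RibbonGraph) : G.numVertices = G.circ ∅ := by
  rw [circ, circSetoid_empty]; rfl

theorem numBoundary_eq (G : RibbonGraph) : G.numBoundary = G.circ Set.univ := rfl

end RibbonGraph

namespace VPRibbonGraph

/-- The number of blocks after the blocks of the ends of each edge in `A` have been merged. -/
noncomputable def blk (G : VPRibbonGraph) (A : Set G.Edge) : ℕ :=
  Nat.card (Quotient (G.block ⊔ G.edgeSetoid A))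

theorem edgeSetoid_corner (G : VPRibbonGraph) {A : Set G.Edge} {e : G.Edge} (he : e ∈ A)
    (s t s' t' : Bool) : G.edgeSetoid A (G.corner e s t) (G.corner e s' t') :=
  Relation.EqvGen.rel _ _ ⟨e, he, s, t, s', t', rfl, rfl⟩

/-! ### Behaviour under isomorphism -/

theorem Iso.circ {G H : VPRibbonGraph} (φ : Iso G H) (A : Set G.Edge) :
    H.circ (φ.edge '' A) = G.circ A := by
  refine (Nat.card_congr (Quotient.congr φ.pt fun x y => ⟨fun h => ?_, fun h => ?_⟩)).symm
  · have : G.circSetoid A ≤ Setoid.comap φ.pt (H.circSetoid (φ.edge '' A)) :=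
      RibbonGraph.circSetoid_le
        (fun p => by rw [Setoid.comap_rel, φ.map_arc]; exact H.circSetoid_arc _ _)
        (fun p => by rw [Setoid.comap_rel, φ.turn]; exact H.circSetoid_turn _ _)
    exact this h
  · have : H.circSetoid (φ.edge '' A) ≤ Setoid.comap φ.pt.symm (G.circSetoid A) := by
      refine RibbonGraph.circSetoid_le (fun p => ?_) (fun p => ?_)
      · obtain ⟨p, rfl⟩ := φ.pt.surjective p
        rw [Setoid.comap_rel, ← φ.map_arc, Equiv.symm_apply_apply, Equiv.symm_apply_apply]
        exact G.circSetoid_arc _ _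
      · obtain ⟨p, rfl⟩ := φ.pt.surjective p
        rw [Setoid.comap_rel, ← φ.turn, Equiv.symm_apply_apply, Equiv.symm_apply_apply]
        exact G.circSetoid_turn _ _
    have := this h
    rwa [Setoid.comap_rel, Equiv.symm_apply_apply, Equiv.symm_apply_apply] at this

/-- The relation counted by `blk A` is the block relation of `G / A`, so the induced isomorphism of
contractions does the work. -/
theorem Iso.blk {G H : VPRibbonGraph} (φ : Iso G H) (A : Set G.Edge) :
    H.blk (φ.edge '' A) = G.blk A :=
  (Nat.card_congr (Quotient.congr φ.pt fun x y => ((φ.contract A).map_block x y).symm)).symm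

/-! ### Behaviour under erasing -/

/-- A new arc replaces a path arc, segment, arc of the old curve, which gives one inclusion. For the
other, the quotient map of the erased graph is extended to the two erased points so that it stays
constant along the generators `arc` and `turn A`. -/
theorem erase_circSetoid (G : VPRibbonGraph) (a : G.Pt) (ha : ∀ e s t, G.corner e s t ≠ a)
    (A : Set G.Edge) : (G.erase a ha).circSetoid A =
      Setoid.comap (Subtype.val : (G.erase a ha).Pt → G.Pt) (G.circSetoid A) := by
  classical
  have hseg : G.turn A a = G.seg a := G.turn_eq_seg fun e _ s t => ha e s t
  have hseg' : G.turn A (G.seg a) = a := by rw [← hseg, G.turn_turn]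
  refine le_antisymm (RibbonGraph.circSetoid_le (fun p => ?_) (fun p => ?_)) ?_
  · have hs := G.circSetoid_turn A a
    rw [hseg] at hs
    have h0 := G.circSetoid_arc A
    change G.circSetoid A p.1 (if G.arc p.1 = a then G.arc (G.seg a) else
            if G.arc p.1 = G.seg a then G.arc a else G.arc p.1)
    split_ifs with h h'
    · have k := h0 p.1
      rw [h] at k
      exact Setoid.trans' _ k (Setoid.trans' _ hs (h0 _))
    · have k := h0 p.1
      rw [h'] at k
      exact Setoid.trans' _ k (Setoid.trans' _ (Setoid.symm' _ hs) (h0 _))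
    · exact h0 _
  · change G.circSetoid A p.1 ((G.erase a ha).turn A p).1
    rw [erase_turn]
    exact G.circSetoid_turn A p.1
  · set S := (G.erase a ha).circSetoid A with hS
    have harc (p : (G.erase a ha).Pt) : S p ((G.erase a ha).arc p) :=
      RibbonGraph.circSetoid_arc _ _ _
    have hturn (p : (G.erase a ha).Pt) : S p ((G.erase a ha).turn A p) :=
      RibbonGraph.circSetoid_turn _ _ _
    by_cases hac : G.arc a = G.seg a
    · have hac' : G.arc (G.seg a) = a := by rw [← hac, G.arc_arc]
      -- Here `a` and `G.seg a` form a whole circle, which gets the separate value `none`.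
      let f : G.Pt → Option (Quotient S) := fun x =>
        if hx : x ≠ a ∧ x ≠ G.seg a then some (Quotient.mk S ⟨x, hx⟩) else none
      have hf (p : (G.erase a ha).Pt) : f p.1 = some (Quotient.mk S p) := dif_pos p.2
      have hfa : f a = none := by simp [f]
      have hfs : f (G.seg a) = none := by simp [f]
      have hle : G.circSetoid A ≤ Setoid.ker f := by
        refine RibbonGraph.circSetoid_le (fun p => ?_) (fun p => ?_) <;> rw [Setoid.ker_def]
        · by_cases h1 : p = a
          · rw [h1, hac, hfa, hfs]
          by_cases h2 : p = G.seg a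
          · rw [h2, hac', hfa, hfs]
          have h3 : ((G.erase a ha).arc ⟨p, h1, h2⟩).1 = G.arc p := by
            change (if G.arc p = a then G.arc (G.seg a) else
              if G.arc p = G.seg a then G.arc a else G.arc p) = _
            have := G.arc_arc
            grind
          rw [← h3, hf, hf ⟨p, h1, h2⟩, Quotient.sound (harc ⟨p, h1, h2⟩)]
        · by_cases h1 : p = a
          · rw [h1, hseg, hfa, hfs]
          by_cases h2 : p = G.seg a
          · rw [h2, hseg', hfa, hfs]
          rw [← erase_turn G a ha A ⟨p, h1, h2⟩, hf, hf ⟨p, h1, h2⟩,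
            Quotient.sound (hturn ⟨p, h1, h2⟩)]
      intro x y hxy
      have := hle hxy
      rw [Setoid.ker_def, hf, hf, Option.some_inj] at this
      exact Quotient.exact this
    · have k1 : G.arc a ≠ a ∧ G.arc a ≠ G.seg a := ⟨G.arc_ne a, hac⟩
      have k2 : G.arc (G.seg a) ≠ a ∧ G.arc (G.seg a) ≠ G.seg a :=
        ⟨fun h => hac (by rw [← G.arc_arc (G.seg a), h]), G.arc_ne _⟩
      let f : G.Pt → Quotient S := fun x =>
        if hx : x ≠ a ∧ x ≠ G.seg a then Quotient.mk S ⟨x, hx⟩ else Quotient.mk S ⟨G.arc a, k1⟩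
      have hf (p : (G.erase a ha).Pt) : f p.1 = Quotient.mk S p := dif_pos p.2
      have hfa : f a = Quotient.mk S ⟨G.arc a, k1⟩ := by simp [f]
      have hfs : f (G.seg a) = Quotient.mk S ⟨G.arc a, k1⟩ := by simp [f]
      -- The outer neighbours of the two erased points are the ends of the new united arc, so one
      -- value serves for both erased points.
      have key : Quotient.mk S ⟨G.arc a, k1⟩ = Quotient.mk S ⟨G.arc (G.seg a), k2⟩ := by
        refine (Quotient.sound (harc ⟨G.arc a, k1⟩)).trans (congrArg _ (Subtype.ext ?_))
        change (if G.arc (G.arc a) = a then G.arc (G.seg a) else _) = _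
        rw [if_pos (G.arc_arc a)]
      have hle : G.circSetoid A ≤ Setoid.ker f := by
        refine RibbonGraph.circSetoid_le (fun p => ?_) (fun p => ?_) <;> rw [Setoid.ker_def]
        · by_cases h1 : p = a
          · rw [h1, hfa, hf ⟨_, k1⟩]
          by_cases h2 : p = G.seg a
          · rw [h2, hfs, hf ⟨_, k2⟩, key]
          by_cases h3 : G.arc p = a
          · have : p = G.arc a := by rw [← h3, G.arc_arc]
            rw [h3, hfa, this, hf ⟨_, k1⟩]
          by_cases h4 : G.arc p = G.seg a
          · have : p = G.arc (G.seg a) := by rw [← h4, G.arc_arc]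
            rw [h4, hfs, this, hf ⟨_, k2⟩, key]
          have h5 : ((G.erase a ha).arc ⟨p, h1, h2⟩).1 = G.arc p := by
            change (if G.arc p = a then G.arc (G.seg a) else
              if G.arc p = G.seg a then G.arc a else G.arc p) = _
            rw [if_neg h3, if_neg h4]
          rw [← h5, hf, hf ⟨p, h1, h2⟩, Quotient.sound (harc ⟨p, h1, h2⟩)]
        · by_cases h1 : p = a
          · rw [h1, hseg, hfa, hfs]
          by_cases h2 : p = G.seg a
          · rw [h2, hseg', hfa, hfs]
          rw [← erase_turn G a ha A ⟨p, h1, h2⟩, hf, hf ⟨p, h1, h2⟩,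
            Quotient.sound (hturn ⟨p, h1, h2⟩)]
      intro x y hxy
      have := hle hxy
      rw [Setoid.ker_def, hf, hf] at this
      exact Quotient.exact this

open Classical in
-- A curve disappears only when an isolated vertex is removed. The correction term does not depend
-- on `A`, so it cancels in `circDrop`.
theorem erase_circ (G : VPRibbonGraph) (a : G.Pt) (ha : ∀ e s t, G.corner e s t ≠ a)
    (A : Set G.Edge) :
    G.circ A = (G.erase a ha).circ A + if G.arc a = G.seg a then 1 else 0 := by
  have hseg : G.turn A a = G.seg a := G.turn_eq_seg fun e _ s t => ha e s t
  have h1 : G.circSetoid A a (G.seg a) := hseg ▸ G.circSetoid_turn A a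
  have h2 : ¬ (a ≠ a ∧ a ≠ G.seg a) := fun h => h.1 rfl
  have h3 : ∀ x, ¬ (x ≠ a ∧ x ≠ G.seg a) → G.circSetoid A x a := by
    intro x hx
    by_cases hxa : x = a
    · rw [hxa]
    · rw [not_not.1 fun h => hx ⟨hxa, h⟩]; exact Setoid.symm' _ h1
  have := card_quotient_comap_val (G.circSetoid A) (fun p => p ≠ a ∧ p ≠ G.seg a) a h3 h2
  change Nat.card (Quotient (G.circSetoid A)) =
    Nat.card (Quotient ((G.erase a ha).circSetoid A)) + _
  rw [erase_circSetoid, this]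
  congr 1
  by_cases hac : G.arc a = G.seg a
  · rw [if_pos hac, if_neg]
    rintro ⟨t, ht, hta⟩
    -- The pair of erased points is closed under `arc` and `turn A`, so its curve contains no other
    -- point.
    have hle : G.circSetoid A ≤ Setoid.ker fun x => x = a ∨ x = G.seg a := by
      have e1 := G.arc_arc
      have e2 := G.turn_turn A
      refine RibbonGraph.circSetoid_le (fun p => ?_) (fun p => ?_) <;> rw [Setoid.ker_def] <;>
        refine propext ?_
      · grind
      · grind
    have := hle hta
    rw [Setoid.ker_def] at this
    simp [ht.1, ht.2] at this
  · rw [if_neg hac, if_pos]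
    exact ⟨G.arc a, ⟨G.arc_ne a, hac⟩, Setoid.symm' _ (G.circSetoid_arc A a)⟩

open Classical in
-- The correction term is expressed by the original partition and not by the merged one, which makes
-- it independent of `A`; it then cancels in `blkDrop`.
theorem erase_blk (G : VPRibbonGraph) (a : G.Pt) (ha : ∀ e s t, G.corner e s t ≠ a)
    (A : Set G.Edge) : G.blk A = (G.erase a ha).blk A +
      if ∃ t, (t ≠ a ∧ t ≠ G.seg a) ∧ G.block t a then 0 else 1 := by
  have hle : G.block ≤ G.block ⊔ G.edgeSetoid A := le_sup_left
  have h2 : ¬ (a ≠ a ∧ a ≠ G.seg a) := fun h => h.1 rfl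
  have h3 : ∀ x, ¬ (x ≠ a ∧ x ≠ G.seg a) → G.block x a := by
    intro x hx
    by_cases hxa : x = a
    · rw [hxa]
    · rw [not_not.1 fun h => hx ⟨hxa, h⟩]; exact Setoid.symm' _ (G.block_seg a)
  have := card_quotient_comap_val (G.block ⊔ G.edgeSetoid A) (fun p => p ≠ a ∧ p ≠ G.seg a) a
    (fun x hx => hle (h3 x hx)) h2
  refine this.trans (congrArg₂ (· + ·) ?_ ?_)
  · refine Nat.card_congr (Quotient.congr (Equiv.refl _) fun x y => ?_)
    exact erase_block_aux G a ha A x y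
  · refine if_congr ⟨?_, ?_⟩ rfl rfl
    · rintro ⟨t, ht, hta⟩
      by_contra hno
      -- If the block of `a` contains only erased points, it contains no corner of an edge, so
      -- merging along `A` leaves it alone.
      have hle' : G.block ⊔ G.edgeSetoid A ≤ Setoid.ker fun x => G.block x a := by
        refine sup_le (fun x y h => ?_) (Setoid.eqvGen_le ?_)
        · exact propext ⟨fun k => Setoid.trans' _ (Setoid.symm' _ h) k,
            fun k => Setoid.trans' _ h k⟩
        · have hc : ∀ e s t, ¬ G.block (G.corner e s t) a := fun e s t h =>
            hno ⟨_, ⟨ha e s t, fun h => ha e s (!t) (by rw [← G.seg_corner, h, G.seg_seg])⟩, h⟩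
          rintro x y ⟨e, -, s, t, s', t', rfl, rfl⟩
          exact propext (iff_of_false (hc _ _ _) (hc _ _ _))
      have := hle' hta
      rw [Setoid.ker_def] at this
      exact hno ⟨t, ht, this.mpr (Setoid.refl' _ _)⟩
    · rintro ⟨t, ht, hta⟩
      exact ⟨t, ht, hle hta⟩

/-! ### Behaviour under joins -/

theorem IsSplitting.corner {G : VPRibbonGraph} {κ : G.Pt → Bool} (hκ : G.IsSplitting κ)
    (e : G.Edge) (s t s' t' : Bool) : κ (G.corner e s t) = κ (G.corner e s' t') := by
  have h1 : ∀ s t, κ (G.corner e s t) = κ (G.corner e false false) := by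
    intro s t
    have h2 : κ (G.corner e s t) = κ (G.corner e s false) := by
      cases t
      · rfl
      · have := hκ.1 _ _ (G.block_seg (G.corner e s false))
        rw [G.seg_corner] at this
        exact this.symm
    rw [h2]
    cases s
    · rfl
    · exact (hκ.2 e).symm
  rw [h1, h1 s']

theorem IsSplitting.blockSetoid_le {G : VPRibbonGraph} {κ : G.Pt → Bool} (hκ : G.IsSplitting κ)
    (A : Set G.Edge) : G.block ⊔ G.edgeSetoid A ≤ Setoid.ker κ := by
  refine sup_le (fun x y h => hκ.1 x y h) (Setoid.eqvGen_le ?_)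
  rintro x y ⟨e, -, s, t, s', t', rfl, rfl⟩
  exact hκ.corner e s t s' t'

theorem IsSplitting.turn {G : VPRibbonGraph} {κ : G.Pt → Bool} (hκ : G.IsSplitting κ)
    (A : Set G.Edge) (p : G.Pt) : κ (G.turn A p) = κ p :=
  (hκ.blockSetoid_le A ((G.contract A).block_seg p)).symm

theorem IsSplitting.arc {G : VPRibbonGraph} {κ : G.Pt → Bool} (hκ : G.IsSplitting κ)
    (p : G.Pt) : κ (G.arc p) = κ p := (hκ.1 _ _ (G.block_arc p)).symm

theorem IsSplitting.circSetoid_le {G : VPRibbonGraph} {κ : G.Pt → Bool} (hκ : G.IsSplitting κ)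
    (A : Set G.Edge) : G.circSetoid A ≤ Setoid.ker κ :=
  RibbonGraph.circSetoid_le (fun p => (hκ.arc p).symm) fun p => (hκ.turn A p).symm

theorem joinAt_turn (G : VPRibbonGraph) (p q : G.Pt) (A : Set G.Edge) (x : G.Pt) :
    (G.joinAt p q).turn A x = G.turn A x := by
  rcases G.turn_cases A x with ⟨e, he, s, t, rfl⟩ | ⟨h, -⟩
  · rw [G.turn_corner he]
    exact (G.joinAt p q).turn_corner he s t
  · rw [G.turn_eq_seg h]
    exact (G.joinAt p q).turn_eq_seg h

open Classical in
/-- The two ends of an arc remain connected when the arc is removed from its circle. -/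
theorem arc_rel_of_avoid (G : VPRibbonGraph) (A : Set G.Edge) (p : G.Pt) (S : Setoid G.Pt)
    (P : G.Pt → Prop) (hp : P p) (hPa : ∀ x, P x → P (G.arc x)) (hPt : ∀ x, P x → P (G.turn A x))
    (h1 : ∀ x, P x → x ≠ p → x ≠ G.arc p → S x (G.arc x)) (h2 : ∀ x, P x → S x (G.turn A x)) :
    S p (G.arc p) := by
  by_contra hno
  let _ : Fintype G.Pt := Fintype.ofFinite _
  -- `turn A` acts on `X` without fixed points, so `X` has even size. If `G.arc p` were not in `X`,
  -- then `arc` would act without fixed points on `X` minus `p`, forcing odd size.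
  let X : Finset G.Pt := Finset.univ.filter fun x => P x ∧ S p x
  have hX (x) : x ∈ X ↔ P x ∧ S p x := by simp [X]
  have hpX : p ∈ X := (hX p).2 ⟨hp, S.refl' p⟩
  have e1 : Even X.card := X.even_card_of_involution (G.turn A)
    (fun x hx => by
      rw [hX] at hx ⊢
      exact ⟨hPt x hx.1, S.trans' hx.2 (h2 x hx.1)⟩)
    (fun x _ => G.turn_turn A x) (fun x _ => G.turn_ne A x)
  have e2 : Even (X.erase p).card := (X.erase p).even_card_of_involution G.arc
    (fun x hx => by
      rw [Finset.mem_erase, hX] at hx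
      have hxa : x ≠ G.arc p := fun h => hno (h ▸ hx.2.2)
      rw [Finset.mem_erase, hX]
      exact ⟨fun h => hxa (by rw [← h, G.arc_arc]), hPa x hx.2.1,
        S.trans' hx.2.2 (h1 x hx.2.1 hx.1 hxa)⟩)
    (fun x _ => G.arc_arc x) (fun x _ => G.arc_ne x)
  rw [Finset.card_erase_of_mem hpX] at e2
  have := Finset.card_pos.2 ⟨p, hpX⟩
  rw [Nat.even_iff] at e1 e2
  omega

/-- The join cuts one arc on each of two curves and links the loose ends crosswise. What remains of
each curve still connects the ends of its cut arc, so the only effect is to merge the two curves. -/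
theorem joinAt_circSetoid (G : VPRibbonGraph) {κ : G.Pt → Bool} (hκ : G.IsSplitting κ)
    {p q : G.Pt} (hpq : κ p ≠ κ q) (A : Set G.Edge) :
    (G.joinAt p q).circSetoid A =
      G.circSetoid A ⊔ Relation.EqvGen.setoid fun x y => x = p ∧ y = q := by
  classical
  set B := G.circSetoid A ⊔ Relation.EqvGen.setoid fun x y => x = p ∧ y = q with hB
  set S := (G.joinAt p q).circSetoid A with hS
  have hka := hκ.arc
  have ha (x : G.Pt) : (G.joinAt p q).arc x =
      Equiv.swap (G.arc p) q (G.arc (Equiv.swap (G.arc p) q x)) := rfl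
  have hSa (x : G.Pt) : S x ((G.joinAt p q).arc x) := RibbonGraph.circSetoid_arc _ _ _
  have hSt (x : G.Pt) : S x (G.turn A x) := by
    rw [← joinAt_turn G p q]; exact RibbonGraph.circSetoid_turn _ _ _
  have n1 : p ≠ q := fun h => hpq (congrArg κ h)
  have n2 : G.arc p ≠ q := fun h => hpq (by rw [← hka p, h])
  have n3 : G.arc q ≠ p := fun h => hpq (by rw [← hka q, h])
  have n4 : G.arc q ≠ G.arc p := fun h => hpq (by rw [← hka q, ← hka p, h])
  have n5 := G.arc_ne
  have n6 := G.arc_arc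
  refine le_antisymm (RibbonGraph.circSetoid_le (fun x => ?_) (fun x => ?_))
    (sup_le (RibbonGraph.circSetoid_le (fun x => ?_) hSt) (Setoid.eqvGen_le ?_))
  · have hle : G.circSetoid A ≤ B := le_sup_left
    have hp : B (G.arc p) q := B.trans' (hle (Setoid.symm' _ (G.circSetoid_arc A p)))
      ((le_sup_right : _ ≤ B) (Relation.EqvGen.rel _ _ ⟨rfl, rfl⟩))
    have hsw : ∀ z, B z (Equiv.swap (G.arc p) q z) := by
      intro z
      rw [Equiv.swap_apply_def]
      split_ifs with h1 h2
      · exact h1 ▸ hp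
      · exact h2 ▸ B.symm' hp
      · exact B.refl' z
    change B x (Equiv.swap (G.arc p) q (G.arc (Equiv.swap (G.arc p) q x)))
    exact B.trans' (hsw x) (B.trans' (hle (G.circSetoid_arc A _)) (hsw _))
  · change B x ((G.joinAt p q).turn A x)
    rw [joinAt_turn G p q A x]
    exact (le_sup_left : _ ≤ B) (G.circSetoid_turn A x)
  · have spq : S p q := by
      have := hSa p
      rwa [ha, Equiv.swap_apply_of_ne_of_ne (n5 p).symm n1, Equiv.swap_apply_left] at this
    have sab : S (G.arc p) (G.arc q) := by
      have := hSa (G.arc p)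
      rwa [ha, Equiv.swap_apply_left, Equiv.swap_apply_of_ne_of_ne n4 (n5 q)] at this
    have hout (x) (h1 : x ≠ p) (h2 : x ≠ G.arc p) (h3 : x ≠ q) (h4 : x ≠ G.arc q) :
        S x (G.arc x) := by
      have := hSa x
      rwa [ha, Equiv.swap_apply_of_ne_of_ne h2 h3, Equiv.swap_apply_of_ne_of_ne] at this
      · exact fun h => h1 (by rw [← n6 x, h, n6])
      · exact fun h => h4 (by rw [← h, n6])
    have spa : S p (G.arc p) := by
      -- Restricting to the colour of `p` keeps the argument away from the other cut arc, the one at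
      -- `q`.
      refine G.arc_rel_of_avoid A p S (fun x => κ x = κ p) rfl (fun x hx => (hka x).trans hx)
        (fun x hx => (hκ.turn A x).trans hx) (fun x hx h1 h2 => hout x h1 h2 ?_ ?_)
        (fun x _ => hSt x)
      · rintro rfl; exact hpq hx.symm
      · rintro rfl; exact hpq (by rw [← hx, hka])
    have sqa : S q (G.arc q) := S.trans' (S.symm' spq) (S.trans' spa sab)
    by_cases h1 : x = p
    · rw [h1]; exact spa
    by_cases h2 : x = G.arc p
    · rw [h2, n6]; exact S.symm' spa
    by_cases h3 : x = q
    · rw [h3]; exact sqa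
    by_cases h4 : x = G.arc q
    · rw [h4, n6]; exact S.symm' sqa
    exact hout x h1 h2 h3 h4
  · rintro x y ⟨rfl, rfl⟩
    have := hSa x
    rwa [ha, Equiv.swap_apply_of_ne_of_ne (n5 x).symm n1, Equiv.swap_apply_left] at this

theorem joinAt_circ (G : VPRibbonGraph) {κ : G.Pt → Bool} (hκ : G.IsSplitting κ)
    {p q : G.Pt} (hpq : κ p ≠ κ q) (A : Set G.Edge) :
    G.circ A = (G.joinAt p q).circ A + 1 := by
  change Nat.card (Quotient (G.circSetoid A)) =
    Nat.card (Quotient ((G.joinAt p q).circSetoid A)) + 1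
  rw [joinAt_circSetoid G hκ hpq]
  exact card_quotient_sup_pair _ fun h => hpq (hκ.circSetoid_le A h)

theorem joinAt_blk (G : VPRibbonGraph) {κ : G.Pt → Bool} (hκ : G.IsSplitting κ)
    {p q : G.Pt} (hpq : κ p ≠ κ q) (A : Set G.Edge) :
    G.blk A = (G.joinAt p q).blk A + 1 := by
  have h : (G.joinAt p q).block ⊔ (G.joinAt p q).edgeSetoid A =
      G.block ⊔ G.edgeSetoid A ⊔ Relation.EqvGen.setoid fun x y => x = p ∧ y = q :=
    sup_right_comm _ _ _
  change Nat.card (Quotient (G.block ⊔ G.edgeSetoid A)) =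
    Nat.card (Quotient ((G.joinAt p q).block ⊔ (G.joinAt p q).edgeSetoid A)) + 1
  rw [h]
  exact card_quotient_sup_pair _ fun h => hpq (hκ.blockSetoid_le A h)

/-! ### Invariants of vertex partitioned ribbon graphs -/

/-- The number of vertices minus the number of boundary components. -/
noncomputable def circDrop (G : VPRibbonGraph) : ℤ := G.circ ∅ - G.circ Set.univ

/-- The number of blocks minus the number of blocks after merging along all edges. -/
noncomputable def blkDrop (G : VPRibbonGraph) : ℤ := G.blk ∅ - G.blk Set.univ

/-- An elementary identification changes `circ A`, and likewise `blk A`, by an amount that is the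
same for all `A`. Differences of two values are therefore invariant. -/
theorem drop_eq_of_step {G H : VPRibbonGraph} (h : Step G H) :
    G.circDrop = H.circDrop ∧ G.blkDrop = H.blkDrop := by
  unfold circDrop blkDrop
  cases h with
  | iso φ =>
    have h1 := φ.circ ∅
    have h2 := φ.circ Set.univ
    have h3 := φ.blk ∅
    have h4 := φ.blk Set.univ
    rw [Set.image_empty] at h1 h3
    rw [Set.image_univ, φ.edge.range_eq_univ] at h2 h4
    rw [h1, h2, h3, h4]
    exact ⟨rfl, rfl⟩
  | erase _ a ha =>
    rw [erase_circ G a ha ∅, erase_circ G a ha Set.univ, erase_blk G a ha ∅,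
      erase_blk G a ha Set.univ]
    constructor <;> push_cast <;> exact add_sub_add_right_eq_sub _ _ _
  | join _ κ hκ p q hpq =>
    rw [joinAt_circ H hκ hpq ∅, joinAt_circ H hκ hpq Set.univ, joinAt_blk H hκ hpq ∅,
      joinAt_blk H hκ hpq Set.univ]
    constructor <;> push_cast <;> exact (add_sub_add_right_eq_sub _ _ _).symm

theorem drop_eq_of_equiv {G H : VPRibbonGraph} (h : G ≈ H) :
    G.circDrop = H.circDrop ∧ G.blkDrop = H.blkDrop := by
  induction h with
  | rel _ _ h => exact drop_eq_of_step h
  | refl _ => exact ⟨rfl, rfl⟩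
  | symm _ _ _ ih => exact ⟨ih.1.symm, ih.2.symm⟩
  | trans _ _ _ _ _ ih₁ ih₂ => exact ⟨ih₁.1.trans ih₂.1, ih₁.2.trans ih₂.2⟩

end VPRibbonGraph

namespace VPRibbonGraph

/-! ### Ranks of minors -/

theorem card_quotient_block (G : VPRibbonGraph) : Nat.card (Quotient G.block) = G.blk ∅ := by
  rw [blk, edgeSetoid_empty, sup_bot_eq]

/-- Components of `G_{/𝒫}`, pulled back to boundary points, are the classes of the join of the block
relation with the relation generated by all edges. -/
theorem numComponents_blockEnds (G : VPRibbonGraph) :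
    numComponents G.blockEnds = G.blk Set.univ := by
  set S := G.block ⊔ G.edgeSetoid Set.univ with hS
  set C := componentSetoid G.blockEnds with hC
  have hle : G.block ≤ S := le_sup_left
  have h1 : S ≤ Setoid.ker fun p => Quotient.mk C (Quotient.mk G.block p) := by
    refine sup_le (fun x y h => ?_) (Setoid.eqvGen_le ?_)
    · exact congrArg (Quotient.mk C) (Quotient.sound h)
    · have hside (e : G.Edge) (s t : Bool) :
          Quotient.mk G.block (G.corner e s t) = G.blockEnds e s := by
        cases t
        · rfl
        · have := G.block_seg (G.corner e s false)
          rw [G.seg_corner] at this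
          exact (Quotient.sound this).symm
      have hend (e : G.Edge) (s s' : Bool) : C (G.blockEnds e s) (G.blockEnds e s') := by
        have : C (G.blockEnds e false) (G.blockEnds e true) :=
          Relation.EqvGen.rel _ _ ⟨e, rfl, rfl⟩
        cases s <;> cases s'
        exacts [C.refl' _, this, C.symm' this, C.refl' _]
      rintro x y ⟨e, -, s, t, s', t', rfl, rfl⟩
      rw [Setoid.ker_def, hside, hside]
      exact Quotient.sound (hend e s s')
  refine (card_quotient_eq (fun p => Quotient.mk C (Quotient.mk G.block p)) ?_ fun x y =>
    ⟨fun h => h1 h, fun h => ?_⟩).symm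
  · exact Quotient.mk_surjective.comp Quotient.mk_surjective
  · have h2 : C ≤ Setoid.ker (Quotient.lift (Quotient.mk S) fun a b hab =>
        Quotient.sound (hle hab)) := by
      refine Setoid.eqvGen_le ?_
      rintro _ _ ⟨e, rfl, rfl⟩
      exact Quotient.sound ((le_sup_right : _ ≤ S)
        (G.edgeSetoid_corner (Set.mem_univ e) false false true false))
    exact Quotient.exact (h2 (Quotient.exact h))

theorem blk_univ_le (G : VPRibbonGraph) : G.blk Set.univ ≤ G.blk ∅ := by
  refine Nat.card_le_card_of_surjective
    (Quotient.map' id fun x y h => ?_ : Quotient (G.block ⊔ G.edgeSetoid ∅) →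
      Quotient (G.block ⊔ G.edgeSetoid Set.univ)) ?_
  · have : G.block ⊔ G.edgeSetoid ∅ ≤ G.block ⊔ G.edgeSetoid Set.univ := by
      rw [edgeSetoid_empty]; exact sup_le le_sup_left bot_le
    exact this h
  · intro x
    induction x using Quotient.inductionOn with | h x => exact ⟨Quotient.mk _ x, rfl⟩

theorem blockRank_eq (G : VPRibbonGraph) : (G.blockRank : ℤ) = G.blkDrop := by
  rw [blockRank, graphRank, numComponents_blockEnds, card_quotient_block,
    Nat.cast_sub G.blk_univ_le, blkDrop]

theorem delete_circ (G : VPRibbonGraph) (A : Set G.Edge) (B : Set ↥Aᶜ) :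
    (G.delete A).circ B = G.circ (Subtype.val '' B) := by
  have : (G.delete A).circSetoid B = G.circSetoid (Subtype.val '' B) := by
    refine le_antisymm (RibbonGraph.circSetoid_le (fun p => G.circSetoid_arc _ p) fun p => ?_)
      (RibbonGraph.circSetoid_le (fun p => (G.delete A).circSetoid_arc _ p) fun p => ?_)
    · change G.circSetoid _ p ((G.delete A).turn B p)
      rw [G.delete_turn A B p]; exact G.circSetoid_turn _ p
    · change (G.delete A).circSetoid B p (G.turn (Subtype.val '' B) p)
      rw [← G.delete_turn A B p]; exact (G.delete A).circSetoid_turn _ p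
  exact congrArg (fun S : Setoid G.Pt => Nat.card (Quotient S)) this

/-- Contraction only redirects `seg` along the ribbons in `A`, so turning along `B` in the
contraction is turning along both sets in `G`. With the analogous facts for deletion and for blocks,
this lets the drops telescope. -/
theorem contract_circ (G : VPRibbonGraph) (A : Set G.Edge) (B : Set ↥Aᶜ) :
    (G.contract A).circ B = G.circ (A ∪ Subtype.val '' B) := by
  have : (G.contract A).circSetoid B = G.circSetoid (A ∪ Subtype.val '' B) := by
    refine le_antisymm (RibbonGraph.circSetoid_le (fun p => G.circSetoid_arc _ p) fun p => ?_)
      (RibbonGraph.circSetoid_le (fun p => (G.contract A).circSetoid_arc _ p) fun p => ?_)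
    · change G.circSetoid _ p ((G.contract A).turn B p)
      rw [G.contract_turn A B p]; exact G.circSetoid_turn _ p
    · change (G.contract A).circSetoid B p (G.turn (A ∪ Subtype.val '' B) p)
      rw [← G.contract_turn A B p]; exact (G.contract A).circSetoid_turn _ p
  exact congrArg (fun S : Setoid G.Pt => Nat.card (Quotient S)) this

theorem delete_blk (G : VPRibbonGraph) (A : Set G.Edge) (B : Set ↥Aᶜ) :
    (G.delete A).blk B = G.blk (Subtype.val '' B) := by
  exact congrArg (fun S : Setoid G.Pt => Nat.card (Quotient (G.block ⊔ S)))
    (G.delete_edgeSetoid A B)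

theorem contract_blk (G : VPRibbonGraph) (A : Set G.Edge) (B : Set ↥Aᶜ) :
    (G.contract A).blk B = G.blk (A ∪ Subtype.val '' B) := by
  have : (G.contract A).block ⊔ (G.contract A).edgeSetoid B =
      G.block ⊔ G.edgeSetoid (A ∪ Subtype.val '' B) := by
    rw [edgeSetoid_union, ← sup_assoc, ← delete_edgeSetoid]; rfl
  exact congrArg (fun S : Setoid G.Pt => Nat.card (Quotient S)) this

theorem delete_compl_circDrop (G : VPRibbonGraph) (A : Set G.Edge) :
    (G.delete Aᶜ).circDrop = G.circ ∅ - G.circ A := by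
  exact (congrArg₂ (fun m n : ℕ => (m : ℤ) - n) (G.delete_circ Aᶜ ∅)
    (G.delete_circ Aᶜ Set.univ)).trans (by simp)

theorem delete_compl_blkDrop (G : VPRibbonGraph) (A : Set G.Edge) :
    (G.delete Aᶜ).blkDrop = G.blk ∅ - G.blk A := by
  exact (congrArg₂ (fun m n : ℕ => (m : ℤ) - n) (G.delete_blk Aᶜ ∅)
    (G.delete_blk Aᶜ Set.univ)).trans (by simp)

theorem contract_circDrop (G : VPRibbonGraph) (A : Set G.Edge) :
    (G.contract A).circDrop = G.circ A - G.circ Set.univ := by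
  exact (congrArg₂ (fun m n : ℕ => (m : ℤ) - n) (G.contract_circ A ∅)
    (G.contract_circ A Set.univ)).trans (by
    rw [Set.image_empty, Set.union_empty, Set.image_univ, Subtype.range_coe, Set.union_compl_self])

theorem contract_blkDrop (G : VPRibbonGraph) (A : Set G.Edge) :
    (G.contract A).blkDrop = G.blk A - G.blk Set.univ := by
  exact (congrArg₂ (fun m n : ℕ => (m : ℤ) - n) (G.contract_blk A ∅)
    (G.contract_blk A Set.univ)).trans (by
    rw [Set.image_empty, Set.union_empty, Set.image_univ, Subtype.range_coe, Set.union_compl_self])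

theorem numEdges_delete_compl (G : VPRibbonGraph) (A : Set G.Edge) :
    (G.delete Aᶜ).numEdges = A.ncard := by
  change Nat.card ↥Aᶜᶜ = _
  rw [compl_compl]; rfl

theorem numEdges_contract (G : VPRibbonGraph) (A : Set G.Edge) :
    (G.contract A).numEdges + A.ncard = G.numEdges := by
  rw [add_comm]; exact Set.ncard_add_ncard_compl A

/-! ### The graphs with one edge -/

/-- As long as some point is not a corner, its segment can be erased, which lowers the number of
points. At the end only the four corners of the single edge remain. -/
theorem exists_equiv_oneEdge (G : VPRibbonGraph) (hG : Nat.card G.Edge = 1) :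
    ∃ arc h1 h2 block h3 h4, G ≈ oneEdge arc h1 h2 block h3 h4 := by
  induction hn : Nat.card G.Pt using Nat.strong_induction_on generalizing G with
  | _ n ih =>
    by_cases h : ∃ a, ∀ e s t, G.corner e s t ≠ a
    · obtain ⟨a, ha⟩ := h
      have hlt : Nat.card (G.erase a ha).Pt < n := by
        rw [← hn]
        exact Finite.card_subtype_lt (x := a) fun h => h.1 rfl
      obtain ⟨arc, h1, h2, block, h3, h4, k⟩ := ih _ hlt (G.erase a ha) hG rfl
      exact ⟨arc, h1, h2, block, h3, h4, Setoid.trans (equiv_of_step (.erase G a ha)) k⟩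
    · push Not at h
      have := (Nat.card_eq_one_iff_unique.1 hG).1
      obtain ⟨e₀⟩ := (Nat.card_eq_one_iff_unique.1 hG).2
      let c : Bool × Bool ≃ G.Pt := Equiv.ofBijective (fun x => G.corner e₀ x.1 x.2) ⟨by
        intro x y hxy
        obtain ⟨-, h1, h2⟩ := G.corner_inj hxy
        exact Prod.ext h1 h2, by
        intro p
        obtain ⟨e, s, t, rfl⟩ := h p
        exact ⟨(s, t), by rw [Subsingleton.elim e e₀]⟩⟩
      have hc (s t) : c (s, t) = G.corner e₀ s t := rfl
      have hseg (x : Bool × Bool) : c (x.1, !x.2) = G.seg (c x) := (G.seg_corner e₀ x.1 x.2).symm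
      refine ⟨fun x => c.symm (G.arc (c x)), by simp [G.arc_arc], fun x hx => ?_,
        Setoid.comap c G.block, fun x => ?_, fun x => ?_,
        Setoid.symm (equiv_of_iso (Iso.ofEq ⟨fun _ => e₀, fun _ => (), fun _ => rfl,
          fun _ => Subsingleton.elim _ _⟩ c (fun p => ?_) (fun p => ?_) (fun _ _ _ => rfl)
          fun _ _ => Iff.rfl))⟩
      · exact G.arc_ne (c x) (by rw [← c.symm_apply_eq]; exact hx)
      · rw [Setoid.comap_rel, Equiv.apply_symm_apply]; exact G.block_arc _
      · rw [Setoid.comap_rel, hseg]; exact G.block_seg _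
      · exact c.apply_symm_apply _
      · exact hseg p

/-- Fixed-point-free involutions of four points are perfect matchings, of which there are three. -/
theorem oneEdge_arc_cases : ∀ (arc : Bool × Bool → Bool × Bool), (∀ p, arc (arc p) = p) →
    (∀ p, arc p ≠ p) → arc = (fun p => (p.1, !p.2)) ∨ arc = (fun p => (!p.1, p.2)) ∨
      arc = (fun p => (!p.1, !p.2)) := by
  set_option maxRecDepth 100000 in decide

theorem setoid_bool_cases (B : Setoid (Bool × Bool)) (h : ∀ p, B p (p.1, !p.2)) :
    B = Setoid.ker Prod.fst ∨ B = ⊤ := by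
  have h1 : ∀ s t t', B (s, t) (s, t') := by
    intro s t t'
    by_cases htt : t' = t
    · rw [htt]
    · rw [Bool.eq_not_of_ne htt]; exact h (s, t)
  by_cases h2 : B (false, false) (true, false)
  · right
    refine top_le_iff.1 ?_
    have h3 : ∀ x, B (false, false) x := by
      rintro ⟨_ | _, t⟩
      · exact h1 _ _ _
      · exact B.trans' h2 (h1 _ _ _)
    exact fun x y _ => B.trans' (B.symm' (h3 x)) (h3 y)
  · left
    ext ⟨s, t⟩ ⟨s', t'⟩
    rw [Setoid.ker_def]
    constructor
    · intro h3
      by_contra hne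
      apply h2
      cases s <;> cases s'
      · exact absurd rfl hne
      · exact B.trans' (h1 _ _ t) (B.trans' h3 (h1 _ _ _))
      · exact B.symm' (B.trans' (h1 _ _ t) (B.trans' h3 (h1 _ _ _)))
      · exact absurd rfl hne
    · rintro rfl
      exact h1 _ _ _

/-- Three arc matchings and two partitions give six combinations. The two loops with separated ends
are impossible, because a block is a union of vertices. -/
theorem equiv_of_card_edge_eq_one (G : VPRibbonGraph) (hG : Nat.card G.Edge = 1) :
    G ≈ bridge ∨ G ≈ orientableLoop ∨ G ≈ nonorientableLoop ∨ G ≈ linkedEdge := by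
  obtain ⟨arc, h1, h2, block, h3, h4, h⟩ := G.exists_equiv_oneEdge hG
  have hb := setoid_bool_cases block h4
  obtain rfl | rfl | rfl := oneEdge_arc_cases arc h1 h2
  · obtain rfl | rfl := hb
    exacts [Or.inl h, Or.inr (Or.inr (Or.inr h))]
  · obtain rfl | rfl := hb
    · simpa [Setoid.ker_def] using h3 (false, false)
    · exact Or.inr (Or.inl h)
  · obtain rfl | rfl := hb
    · simpa [Setoid.ker_def] using h3 (false, false)
    · exact Or.inr (Or.inr (Or.inl h))

theorem oneEdge_turn_univ (arc h1 h2 block h3 h4) (p : Bool × Bool) :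
    (oneEdge arc h1 h2 block h3 h4).turn Set.univ p = (!p.1, p.2) :=
  (oneEdge arc h1 h2 block h3 h4).turn_corner (Set.mem_univ ()) p.1 p.2

theorem oneEdge_turn_empty (arc h1 h2 block h3 h4) (p : Bool × Bool) :
    (oneEdge arc h1 h2 block h3 h4).turn ∅ p = (p.1, !p.2) :=
  (oneEdge arc h1 h2 block h3 h4).turn_empty p

/-- The map `f` labels the curves. On four points, two fixed-point-free involutions reach everything
on a curve within the four words listed in `k3`, so the conditions on `f` can be decided. -/
theorem oneEdge_circ_empty_of (arc h1 h2 block h3 h4) {α : Type} (f : Bool × Bool → α)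
    (hf : f.Surjective) (k1 : ∀ p, f (arc p) = f p) (k2 : ∀ p, f (p.1, !p.2) = f p)
    (k3 : ∀ p q, f p = f q → q = p ∨ q = arc p ∨ q = (p.1, !p.2) ∨
      q = ((arc p).1, !(arc p).2)) :
    (oneEdge arc h1 h2 block h3 h4).circ ∅ = Nat.card α := by
  set G := oneEdge arc h1 h2 block h3 h4
  have ha (p : Bool × Bool) : G.circSetoid ∅ p (arc p) := G.circSetoid_arc ∅ p
  have ht (p : Bool × Bool) : G.circSetoid ∅ p (p.1, !p.2) := by
    have := G.circSetoid_turn ∅ p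
    rwa [oneEdge_turn_empty] at this
  have hle : G.circSetoid ∅ ≤ Setoid.ker f :=
    RibbonGraph.circSetoid_le (fun p => (k1 p).symm)
      fun p => ((congrArg f (oneEdge_turn_empty arc h1 h2 block h3 h4 p)).trans (k2 p)).symm
  refine card_quotient_eq f hf fun x y => ⟨fun h => hle h, fun h => ?_⟩
  obtain rfl | rfl | rfl | rfl := k3 x y h
  exacts [Setoid.refl' _ _, ha x, ht x, Setoid.trans' _ (ha x) (ht _)]

theorem oneEdge_circ_univ_of (arc h1 h2 block h3 h4) {α : Type} (f : Bool × Bool → α)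
    (hf : f.Surjective) (k1 : ∀ p, f (arc p) = f p) (k2 : ∀ p, f (!p.1, p.2) = f p)
    (k3 : ∀ p q, f p = f q → q = p ∨ q = arc p ∨ q = (!p.1, p.2) ∨
      q = (!(arc p).1, (arc p).2)) :
    (oneEdge arc h1 h2 block h3 h4).circ Set.univ = Nat.card α := by
  set G := oneEdge arc h1 h2 block h3 h4
  have ha (p : Bool × Bool) : G.circSetoid Set.univ p (arc p) := G.circSetoid_arc Set.univ p
  have ht (p : Bool × Bool) : G.circSetoid Set.univ p (!p.1, p.2) := by
    have := G.circSetoid_turn Set.univ p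
    rwa [oneEdge_turn_univ] at this
  have hle : G.circSetoid Set.univ ≤ Setoid.ker f :=
    RibbonGraph.circSetoid_le (fun p => (k1 p).symm)
      fun p => ((congrArg f (oneEdge_turn_univ arc h1 h2 block h3 h4 p)).trans (k2 p)).symm
  refine card_quotient_eq f hf fun x y => ⟨fun h => hle h, fun h => ?_⟩
  obtain rfl | rfl | rfl | rfl := k3 x y h
  exacts [Setoid.refl' _ _, ha x, ht x, Setoid.trans' _ (ha x) (ht _)]

theorem oneEdge_blkDrop (arc h1 h2 block h3 h4) :
    (oneEdge arc h1 h2 block h3 h4).blkDrop = Nat.card (Quotient block) - 1 := by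
  set G := oneEdge arc h1 h2 block h3 h4
  have htop (x y : Bool × Bool) : (G.block ⊔ G.edgeSetoid Set.univ) x y :=
    (le_sup_right : _ ≤ G.block ⊔ G.edgeSetoid Set.univ)
      (G.edgeSetoid_corner (Set.mem_univ ()) x.1 x.2 y.1 y.2)
  have h : G.blk Set.univ = 1 :=
    (card_quotient_eq (fun _ => ()) (fun _ => ⟨(false, false), rfl⟩)
      fun x y => iff_of_true (htop x y) rfl).trans Nat.card_unique
  rw [blkDrop, h, ← card_quotient_block, Nat.cast_one]
  rfl

theorem card_quotient_top_bool : Nat.card (Quotient (⊤ : Setoid (Bool × Bool))) = 1 :=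
  (card_quotient_eq (fun _ => ()) (fun _ => ⟨(false, false), rfl⟩)
    fun _ _ => iff_of_true trivial rfl).trans Nat.card_unique

/-- The pairs of drops of the four one-edge graphs are pairwise distinct: they separate the basis
elements of degree one and supply the values of the exponents there. -/
theorem bridge_drop : bridge.circDrop = 1 ∧ bridge.blkDrop = 1 := by
  constructor
  · rw [circDrop, bridge, oneEdge_circ_empty_of (f := Prod.fst) (hf := Prod.fst_surjective)
      (k1 := by decide) (k2 := by decide) (k3 := by decide),
      oneEdge_circ_univ_of (f := fun _ => ()) (hf := fun _ => ⟨(false, false), rfl⟩)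
      (k1 := by decide) (k2 := by decide) (k3 := by decide)]
    simp
  · rw [bridge, oneEdge_blkDrop, card_quotient_eq Prod.fst Prod.fst_surjective fun _ _ => Iff.rfl]
    simp

theorem linkedEdge_drop : linkedEdge.circDrop = 1 ∧ linkedEdge.blkDrop = 0 := by
  constructor
  · rw [circDrop, linkedEdge, oneEdge_circ_empty_of (f := Prod.fst) (hf := Prod.fst_surjective)
      (k1 := by decide) (k2 := by decide) (k3 := by decide),
      oneEdge_circ_univ_of (f := fun _ => ()) (hf := fun _ => ⟨(false, false), rfl⟩)
      (k1 := by decide) (k2 := by decide) (k3 := by decide)]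
    simp
  · rw [linkedEdge, oneEdge_blkDrop, card_quotient_top_bool]
    simp

theorem orientableLoop_drop : orientableLoop.circDrop = -1 ∧ orientableLoop.blkDrop = 0 := by
  constructor
  · rw [circDrop, orientableLoop,
      oneEdge_circ_empty_of (f := fun _ => ()) (hf := fun _ => ⟨(false, false), rfl⟩)
      (k1 := by decide) (k2 := by decide) (k3 := by decide),
      oneEdge_circ_univ_of (f := Prod.snd) (hf := Prod.snd_surjective)
      (k1 := by decide) (k2 := by decide) (k3 := by decide)]
    simp
  · rw [orientableLoop, oneEdge_blkDrop, card_quotient_top_bool]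
    simp

theorem nonorientableLoop_drop :
    nonorientableLoop.circDrop = 0 ∧ nonorientableLoop.blkDrop = 0 := by
  constructor
  · rw [circDrop, nonorientableLoop,
      oneEdge_circ_empty_of (f := fun _ => ()) (hf := fun _ => ⟨(false, false), rfl⟩)
      (k1 := by decide) (k2 := by decide) (k3 := by decide),
      oneEdge_circ_univ_of (f := fun _ => ()) (hf := fun _ => ⟨(false, false), rfl⟩)
      (k1 := by decide) (k2 := by decide) (k3 := by decide)]
    simp
  · rw [nonorientableLoop, oneEdge_blkDrop, card_quotient_top_bool]
    simp

end VPRibbonGraph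

namespace VPRibbonGraph

/-! ### The excess -/

/-- The number of edges minus the rank `r(G_{/𝒫})`. -/
noncomputable def nullity (G : VPRibbonGraph) : ℕ := G.numEdges - G.blockRank

/-- `2 (ρ(G) - r(G_{/𝒫}))`. -/
noncomputable def excess (G : VPRibbonGraph) : ℕ :=
  (G.numEdges + G.circDrop - 2 * G.blkDrop).toNat

theorem drop_of_numEdges_eq_one (G : VPRibbonGraph) (hG : G.numEdges = 1) :
    (G.circDrop = 1 ∧ G.blkDrop = 1) ∨ (G.circDrop = -1 ∧ G.blkDrop = 0) ∨
      (G.circDrop = 0 ∧ G.blkDrop = 0) ∨ (G.circDrop = 1 ∧ G.blkDrop = 0) := by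
  rcases G.equiv_of_card_edge_eq_one hG with h | h | h | h <;>
    rw [(drop_eq_of_equiv h).1, (drop_eq_of_equiv h).2]
  · exact Or.inl bridge_drop
  · exact Or.inr (Or.inl orientableLoop_drop)
  · exact Or.inr (Or.inr (Or.inl nonorientableLoop_drop))
  · exact Or.inr (Or.inr (Or.inr linkedEdge_drop))

/-- The value `circ A` is the end of the first drop and the start of the second, and cancels. -/
theorem circDrop_add (G : VPRibbonGraph) (A : Set G.Edge) :
    (G.delete Aᶜ).circDrop + (G.contract A).circDrop = G.circDrop := by
  rw [delete_compl_circDrop, contract_circDrop, circDrop]; ring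

theorem blkDrop_add (G : VPRibbonGraph) (A : Set G.Edge) :
    (G.delete Aᶜ).blkDrop + (G.contract A).blkDrop = G.blkDrop := by
  rw [delete_compl_blkDrop, contract_blkDrop, blkDrop]; ring

theorem numEdges_add (G : VPRibbonGraph) (A : Set G.Edge) :
    (G.delete Aᶜ).numEdges + (G.contract A).numEdges = G.numEdges := by
  rw [numEdges_delete_compl, add_comm, numEdges_contract]

/-- Both inequalities are additive under splitting off one edge, and hold for the four one-edge
graphs. The first says that `excess` is not truncated, the second that it is at most twice the
nullity; together they show that the nullity is not truncated either. -/
theorem drop_bounds (G : VPRibbonGraph) :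
    2 * G.blkDrop ≤ G.numEdges + G.circDrop ∧ G.circDrop ≤ G.numEdges := by
  induction hn : G.numEdges generalizing G with
  | zero =>
    have : IsEmpty G.Edge := by
      rw [RibbonGraph.numEdges, Finite.card_eq_zero_iff] at hn; exact hn
    have h : (Set.univ : Set G.Edge) = ∅ := Set.univ_eq_empty_iff.2 this
    rw [blkDrop, circDrop, h]
    simp
  | succ n ih =>
    have : Nonempty G.Edge := by
      by_contra h
      rw [not_nonempty_iff] at h
      rw [RibbonGraph.numEdges, Nat.card_of_isEmpty] at hn
      omega
    obtain ⟨e⟩ := this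
    have h1 := G.numEdges_add {e}
    have h2 : (G.delete {e}ᶜ).numEdges = 1 := by rw [numEdges_delete_compl, Set.ncard_singleton]
    have h3 := ih (G.contract {e}) (by omega)
    have h4 := G.circDrop_add {e}
    have h5 := G.blkDrop_add {e}
    have h6 := (G.delete {e}ᶜ).drop_of_numEdges_eq_one h2
    push_cast
    omega

theorem nullity_cast (G : VPRibbonGraph) : (G.nullity : ℤ) = G.numEdges - G.blkDrop := by
  have h1 := G.drop_bounds
  have h2 := G.blockRank_eq
  rw [nullity]
  omega

theorem excess_cast (G : VPRibbonGraph) :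
    (G.excess : ℤ) = G.numEdges + G.circDrop - 2 * G.blkDrop := by
  have h1 := G.drop_bounds
  rw [excess]
  omega

theorem excess_le (G : VPRibbonGraph) : G.excess ≤ 2 * G.nullity := by
  have h1 := G.drop_bounds
  have h2 := G.nullity_cast
  have h3 := G.excess_cast
  omega

theorem blockRank_add (G : VPRibbonGraph) (A : Set G.Edge) :
    (G.delete Aᶜ).blockRank + (G.contract A).blockRank = G.blockRank := by
  have := G.blkDrop_add A
  rw [← blockRank_eq, ← blockRank_eq, ← blockRank_eq] at this
  exact_mod_cast this

theorem nullity_add (G : VPRibbonGraph) (A : Set G.Edge) :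
    (G.delete Aᶜ).nullity + (G.contract A).nullity = G.nullity := by
  have h1 := G.blkDrop_add A
  have h2 := G.numEdges_add A
  have h3 := (G.delete Aᶜ).nullity_cast
  have h4 := (G.contract A).nullity_cast
  have h5 := G.nullity_cast
  omega

theorem excess_add (G : VPRibbonGraph) (A : Set G.Edge) :
    (G.delete Aᶜ).excess + (G.contract A).excess = G.excess := by
  have h1 := G.blkDrop_add A
  have h2 := G.numEdges_add A
  have h3 := (G.delete Aᶜ).excess_cast
  have h4 := (G.contract A).excess_cast
  have h5 := G.excess_cast
  have h6 := G.circDrop_add A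
  omega

theorem rho_eq (G : VPRibbonGraph) : G.rho = ((G.numEdges + G.circDrop : ℤ) : ℚ) / 2 := by
  rw [RibbonGraph.rho, circDrop, RibbonGraph.numVertices_eq, RibbonGraph.numBoundary_eq]
  push_cast
  ring

/-- With `two_mul_rho_sub`, this turns the half-integer exponents of the state sum into integer
exponents of the chosen square roots. -/
theorem two_mul_sub_rho (G : VPRibbonGraph) :
    2 * ((G.numEdges : ℚ) - G.rho) = ((2 * G.nullity - G.excess : ℤ) : ℚ) := by
  rw [rho_eq, nullity_cast, excess_cast]
  push_cast
  ring

theorem two_mul_rho_sub (G : VPRibbonGraph) :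
    2 * (G.rho - G.blockRank) = ((G.excess : ℤ) : ℚ) := by
  have h : (G.blockRank : ℚ) = (G.blkDrop : ℚ) := by exact_mod_cast G.blockRank_eq
  rw [rho_eq, excess_cast, h]
  push_cast
  ring

end VPRibbonGraph

/-- For singleton blocks the rank is `v - c`, so both sides are `2c + e - v - f`; since `excess` is
a natural number, the subtraction in the genus does not truncate. -/
theorem RibbonGraph.eulerGenus_eq (G : RibbonGraph) : G.eulerGenus = G.discrete.excess := by
  have h1 := G.discrete.excess_cast
  have h2 : numComponents G.ends = G.discrete.blk Set.univ :=
    G.discrete.numComponents_blockEnds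
  have h3 : G.numVertices = G.discrete.blk ∅ := G.discrete.card_quotient_block
  have h4 : G.discrete.circDrop = G.numVertices - G.numBoundary := by
    rw [G.numVertices_eq, G.numBoundary_eq]; rfl
  have h5 : G.discrete.blkDrop = G.discrete.blk ∅ - G.discrete.blk Set.univ := rfl
  have h6 : G.discrete.numEdges = G.numEdges := rfl
  rw [eulerGenus]
  omega

/-! ### Weights -/

section Weight

variable {R : Type*} [CommRing R]

/-- The product of `r` factors `a₁` and of `N` factors among `a₂`, `a₃`, `a₄`, where `a₃` counts
once and `a₄` counts twice towards `M`. -/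
def monomialWeight (a : Fin 4 → R) (r N M : ℕ) : R :=
  a 0 ^ r * (a 3 ^ (M / 2) * a 2 ^ (M % 2) * a 1 ^ (N - M % 2 - M / 2))

/-- A normal form free of division and truncated subtraction: `c` is the parity bit of the excess.
As the weight uses no square roots or inverses, it makes sense for arbitrary ring elements. -/
theorem monomialWeight_eq (a : Fin 4 → R) (r k c j : ℕ) (hc : c < 2) :
    monomialWeight a r (k + c + j) (2 * k + c) = a 0 ^ r * (a 3 ^ k * a 2 ^ c * a 1 ^ j) := by
  have h1 : (2 * k + c) / 2 = k := by omega
  have h2 : (2 * k + c) % 2 = c := by omega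
  have h3 : k + c + j - c - k = j := by omega
  rw [monomialWeight, h1, h2, h3]

theorem exists_weight_decomposition {N M : ℕ} (h : M ≤ 2 * N) :
    ∃ k c j, c < 2 ∧ N = k + c + j ∧ M = 2 * k + c :=
  ⟨M / 2, M % 2, N - M % 2 - M / 2, by omega, by omega, by omega⟩

/-- Exponents add, except that two odd parity bits produce a carry: the two factors `a 2` have to be
exchanged for `a 1 * a 3`. This is exactly where the condition on the selector enters. -/
theorem monomialWeight_mul {a : Fin 4 → R} (ha : a 2 ^ 2 = a 1 * a 3) {N M N' M' : ℕ}
    (h : M ≤ 2 * N) (h' : M' ≤ 2 * N') (r r' : ℕ) :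
    monomialWeight a r N M * monomialWeight a r' N' M' =
      monomialWeight a (r + r') (N + N') (M + M') := by
  obtain ⟨k, c, j, hc, rfl, rfl⟩ := exists_weight_decomposition h
  obtain ⟨k', c', j', hc', rfl, rfl⟩ := exists_weight_decomposition h'
  rw [monomialWeight_eq _ _ _ _ _ hc, monomialWeight_eq _ _ _ _ _ hc']
  by_cases hcc : c + c' < 2
  · have e1 : k + c + j + (k' + c' + j') = (k + k') + (c + c') + (j + j') := by ring
    have e2 : 2 * k + c + (2 * k' + c') = 2 * (k + k') + (c + c') := by ring
    rw [e1, e2, monomialWeight_eq _ _ _ _ _ hcc]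
    ring
  · obtain rfl : c = 1 := by omega
    obtain rfl : c' = 1 := by omega
    have e1 : k + 1 + j + (k' + 1 + j') = (k + k' + 1) + 0 + (j + j' + 1) := by ring
    have e2 : 2 * k + 1 + (2 * k' + 1) = 2 * (k + k' + 1) + 0 := by ring
    rw [e1, e2, monomialWeight_eq _ _ _ _ _ two_pos]
    linear_combination a 0 ^ (r + r') * a 3 ^ (k + k') * a 1 ^ (j + j') * ha

theorem monomialWeight_zero (a : Fin 4 → R) : monomialWeight a 0 0 0 = 1 := by
  simp [monomialWeight]

theorem prod_monomialWeight {a : Fin 4 → R} (ha : a 2 ^ 2 = a 1 * a 3) {ι : Type*}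
    (s : Finset ι) (r N M : ι → ℕ) (h : ∀ i, M i ≤ 2 * N i) :
    ∏ i ∈ s, monomialWeight a (r i) (N i) (M i) =
      monomialWeight a (∑ i ∈ s, r i) (∑ i ∈ s, N i) (∑ i ∈ s, M i) := by
  classical
  induction s using Finset.induction_on with
  | empty => simp [monomialWeight_zero]
  | insert i s hi ih =>
    rw [Finset.prod_insert hi, Finset.sum_insert hi, Finset.sum_insert hi, Finset.sum_insert hi,
      ih, monomialWeight_mul ha (h i)]
    rw [Finset.mul_sum]
    exact Finset.sum_le_sum fun i _ => h i

/-- In the normal form the powers are `s ^ (2 * j + c)` and `t ^ (2 * k + c)`. -/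
theorem monomialWeight_units (x s t : Rˣ) {r N M : ℕ} (h : M ≤ 2 * N) :
    monomialWeight ![(x : R), s ^ 2, s * t, t ^ 2] r N M =
      ((x ^ (r : ℤ) * s ^ (2 * N - M : ℤ) * t ^ (M : ℤ) : Rˣ) : R) := by
  obtain ⟨k, c, j, hc, rfl, rfl⟩ := exists_weight_decomposition h
  rw [monomialWeight_eq _ _ _ _ _ hc]
  have e1 : (2 * (k + c + j : ℕ) - (2 * k + c : ℕ) : ℤ) = (2 * j + c : ℕ) := by push_cast; ring
  rw [e1, zpow_natCast, zpow_natCast, zpow_natCast]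
  simp only [Matrix.cons_val, Units.val_mul, Units.val_pow_eq_pow_val]
  ring

/-- The common value of the products of the values of a selector along orderings of the edges. -/
noncomputable def VPRibbonGraph.weight (G : VPRibbonGraph) (a : Fin 4 → R) : R :=
  monomialWeight a G.blockRank G.nullity G.excess

theorem VPRibbonGraph.weight_mul (G : VPRibbonGraph) {a : Fin 4 → R} (ha : a 2 ^ 2 = a 1 * a 3)
    (A : Set G.Edge) : (G.delete Aᶜ).weight a * (G.contract A).weight a = G.weight a := by
  rw [weight, weight, weight, monomialWeight_mul ha (excess_le _) (excess_le _), blockRank_add,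
    nullity_add, excess_add]

/-- Without edges, the drop bounds and the nonnegativity of the rank force both drops to vanish. -/
theorem VPRibbonGraph.weight_of_numEdges_eq_zero (G : VPRibbonGraph) (a : Fin 4 → R)
    (hG : G.numEdges = 0) : G.weight a = 1 := by
  have h1 := G.drop_bounds
  have h2 := G.blockRank_eq
  have h3 := G.nullity_cast
  have h4 := G.excess_cast
  have e1 : G.blockRank = 0 := by omega
  have e2 : G.nullity = 0 := by omega
  have e3 : G.excess = 0 := by omega
  rw [weight, e1, e2, e3, monomialWeight_zero]

end Weight

/-! ### Selectors -/

namespace Hvrg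

open VPRibbonGraph

theorem degree_gen (i : Fin 4) : (gen i).degree = 1 := by
  fin_cases i <;> exact Nat.card_unique (α := Unit)

theorem gen_injective : Function.Injective gen := by
  have key {G H : VPRibbonGraph} (h : G.cls = H.cls) := drop_eq_of_equiv (Quotient.exact h)
  have hb := bridge_drop
  have ho := orientableLoop_drop
  have hn := nonorientableLoop_drop
  have hl := linkedEdge_drop
  intro i j h
  fin_cases i <;> fin_cases j <;> first | rfl | (exfalso; have := key h; omega)

variable {K : Type*} [CommRing K] {R : Type*} [CommRing R] [Algebra K R]

theorem indicator_of (i : Fin 4) (G : VPRibbonGraph) [Decidable (G.cls = gen i)] :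
    indicator i (of K G) = if G.cls = gen i then (1 : K) else 0 := by
  classical
  rw [indicator, of, Module.Basis.coord_apply, Module.Basis.repr_self, Finsupp.single_apply]

theorem selector_of_gen (a : Fin 4 → R) {G : VPRibbonGraph} {i : Fin 4} (h : G.cls = gen i) :
    selector a (of K G) = a i := by
  classical
  rw [selector, LinearMap.sum_apply, Finset.sum_eq_single i]
  · rw [LinearMap.smulRight_apply, indicator_of, if_pos h, one_smul]
  · intro j _ hj
    rw [LinearMap.smulRight_apply, indicator_of, if_neg, zero_smul]
    exact fun k => hj (gen_injective (k.symm.trans h))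
  · simp

/-- The triples of rank, nullity and excess for `b`, `o`, `n`, `l` are `(1,0,0)`, `(0,1,0)`,
`(0,1,1)`, `(0,1,2)`, and their weights are the entries of `a`. -/
theorem selector_of (a : Fin 4 → R) (G : VPRibbonGraph) :
    selector a (of K G) = if G.numEdges = 1 then G.weight a else 0 := by
  classical
  split_ifs with hG
  · have h1 := G.blockRank_eq
    have h2 := G.nullity_cast
    have h3 := G.excess_cast
    have key (i : Fin 4) (r N M : ℕ) (h : G.cls = gen i) (er : G.blockRank = r)
        (eN : G.nullity = N) (eM : G.excess = M) (hw : monomialWeight a r N M = a i) :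
        selector a (of K G) = G.weight a := by
      rw [selector_of_gen a h, weight, er, eN, eM, hw]
    rcases G.equiv_of_card_edge_eq_one hG with h | h | h | h <;>
      have hd := drop_eq_of_equiv h
    · have hb := bridge_drop
      exact key 0 1 0 0 (cls_eq h) (by omega) (by omega) (by omega) (by simp [monomialWeight])
    · have hb := orientableLoop_drop
      exact key 1 0 1 0 (cls_eq h) (by omega) (by omega) (by omega) (by simp [monomialWeight])
    · have hb := nonorientableLoop_drop
      exact key 2 0 1 1 (cls_eq h) (by omega) (by omega) (by omega) (by simp [monomialWeight])
    · have hb := linkedEdge_drop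
      exact key 3 0 1 2 (cls_eq h) (by omega) (by omega) (by omega) (by simp [monomialWeight])
  · rw [selector, LinearMap.sum_apply]
    refine Finset.sum_eq_zero fun i _ => ?_
    rw [LinearMap.smulRight_apply, indicator_of, if_neg, zero_smul]
    intro h
    exact hG ((congrArg VRClass.degree h).trans (degree_gen i))

/-! ### Uniformity -/

theorem minor_edges_empty {E : Type*} (C : Set E) (D : Set ↥Cᶜ) :
    C ∪ Subtype.val '' (Subtype.val '' (∅ : Set ↥Dᶜ)) = C := by
  rw [Set.image_empty, Set.image_empty, Set.union_empty]

theorem minor_edges_univ {E : Type*} (C : Set E) (D : Set ↥Cᶜ) :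
    C ∪ Subtype.val '' (Subtype.val '' (Set.univ : Set ↥Dᶜ)) = C ∪ Subtype.val '' Dᶜ := by
  rw [Set.image_univ, Subtype.range_coe]

theorem minor_circDrop (G : VPRibbonGraph) (C : Set G.Edge) (D : Set ↥Cᶜ) :
    VPRibbonGraph.circDrop ((G.contract C).delete D) =
      G.circ C - G.circ (C ∪ Subtype.val '' Dᶜ) := by
  refine (congrArg₂ (fun m n : ℕ => (m : ℤ) - n) (((G.contract C).delete_circ D ∅).trans
    (G.contract_circ C _)) (((G.contract C).delete_circ D Set.univ).trans
    (G.contract_circ C _))).trans ?_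
  exact congrArg₂ (fun X Y : Set G.Edge => (G.circ X : ℤ) - G.circ Y)
    (minor_edges_empty C D) (minor_edges_univ C D)

theorem minor_blkDrop (G : VPRibbonGraph) (C : Set G.Edge) (D : Set ↥Cᶜ) :
    VPRibbonGraph.blkDrop ((G.contract C).delete D) =
      G.blk C - G.blk (C ∪ Subtype.val '' Dᶜ) := by
  refine (congrArg₂ (fun m n : ℕ => (m : ℤ) - n) (((G.contract C).delete_blk D ∅).trans
    (G.contract_blk C _)) (((G.contract C).delete_blk D Set.univ).trans
    (G.contract_blk C _))).trans ?_
  exact congrArg₂ (fun X Y : Set G.Edge => (G.blk X : ℤ) - G.blk Y)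
    (minor_edges_empty C D) (minor_edges_univ C D)

section Factor

variable (G : VPRibbonGraph) {m : ℕ} (σ : G.Edge ≃ Fin m) (k : Fin m)

/-- The first `j` edges in an ordering of the edges. -/
def initialEdges (j : ℕ) : Set G.Edge := {e | (σ e : ℕ) < j}

theorem initialEdges_zero : initialEdges G σ 0 = ∅ := by
  ext e; simp [initialEdges]

theorem initialEdges_last : initialEdges G σ m = Set.univ := by
  ext e; simp [initialEdges]

/-- The `k`-th factor retains exactly the edge in position `k`, so its drops compare the first `k`
with the first `k + 1` edges. -/
theorem initialEdges_succ :
    {e | σ e < k} ∪ Subtype.val '' {e : ↥{e | σ e < k}ᶜ | k < σ e.1}ᶜ =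
      initialEdges G σ (k + 1) := by
  ext e
  simp only [initialEdges, Set.mem_union, Set.mem_image, Subtype.exists, Set.mem_compl_iff,
    Set.mem_ofPred_eq, exists_and_right, exists_eq_right, Fin.lt_def]
  constructor
  · rintro (h | ⟨h1, h2⟩) <;> omega
  · intro h
    by_cases h1 : (σ e : ℕ) < k
    · exact Or.inl h1
    · exact Or.inr ⟨h1, by omega⟩

theorem factor_circDrop : (factor G σ k).circDrop =
    G.circ (initialEdges G σ k) - G.circ (initialEdges G σ (k + 1)) := by
  rw [← initialEdges_succ]
  exact minor_circDrop G {e | σ e < k} {e | k < σ e.1}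

theorem factor_blkDrop : (factor G σ k).blkDrop =
    G.blk (initialEdges G σ k) - G.blk (initialEdges G σ (k + 1)) := by
  rw [← initialEdges_succ]
  exact minor_blkDrop G {e | σ e < k} {e | k < σ e.1}

theorem factor_numEdges : (factor G σ k).numEdges = 1 := by
  refine Nat.card_eq_one_iff_exists.2 ⟨⟨⟨σ.symm k, ?_⟩, ?_⟩, ?_⟩
  · simp
  · change ¬ k < σ (σ.symm k)
    simp
  · rintro ⟨⟨e, he⟩, he'⟩
    refine Subtype.ext (Subtype.ext ?_)
    change e = σ.symm k
    rw [Equiv.eq_symm_apply]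
    exact le_antisymm (not_lt.1 he') (not_lt.1 he)

theorem sum_initialEdges (c : Set G.Edge → ℕ) :
    ∑ k : Fin m, ((c (initialEdges G σ k) : ℤ) - c (initialEdges G σ (k + 1))) =
      c ∅ - c Set.univ := by
  rw [Fin.sum_univ_eq_sum_range
    (fun k => (c (initialEdges G σ k) : ℤ) - c (initialEdges G σ (k + 1))),
    Finset.sum_range_sub', initialEdges_zero, initialEdges_last]

/-- The drops of the factors telescope along the ordering, so the exponents add up to those of `G`;
no trace of `σ` is left, which is uniformity. -/
theorem prod_selector_factor {a : Fin 4 → R} (ha : a 2 ^ 2 = a 1 * a 3) :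
    ∏ k, selector a (of K (factor G σ k)) = G.weight a := by
  have h1 : ∑ k, (factor G σ k).circDrop = G.circDrop := by
    simp_rw [factor_circDrop]; exact sum_initialEdges G σ G.circ
  have h2 : ∑ k, (factor G σ k).blkDrop = G.blkDrop := by
    simp_rw [factor_blkDrop]; exact sum_initialEdges G σ G.blk
  have h3 : ∑ k, ((factor G σ k).numEdges : ℤ) = G.numEdges := by
    simp_rw [factor_numEdges]
    rw [RibbonGraph.numEdges, Nat.card_congr σ]
    simp
  have e1 : ∑ k, (factor G σ k).blockRank = G.blockRank := by
    zify
    simp_rw [blockRank_eq]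
    exact h2
  have e2 : ∑ k, (factor G σ k).nullity = G.nullity := by
    zify
    simp_rw [nullity_cast]
    rw [Finset.sum_sub_distrib, h2, h3]
  have e3 : ∑ k, (factor G σ k).excess = G.excess := by
    zify
    simp_rw [excess_cast]
    rw [Finset.sum_sub_distrib, Finset.sum_add_distrib, ← Finset.mul_sum, h1, h2, h3]
  simp_rw [selector_of, factor_numEdges, if_true, weight]
  rw [prod_monomialWeight ha _ _ _ _ fun k => excess_le _, e1, e2, e3]

end Factor

/-! ### Convolution -/

theorem conv_of (f g : Hvrg K →ₗ[K] R) (G : VPRibbonGraph) :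
    (WithConv.toConv f * WithConv.toConv g).ofConv (of K G) =
      ∑ A : Set G.Edge, f (of K (G.delete Aᶜ)) * g (of K (G.contract A)) := by
  rw [LinearMap.convMul_apply, comul_of, coprod, map_sum, map_sum]
  rfl

theorem sum_ncard_eq_one {E : Type*} [Finite E] [Fintype (Set E)] (c : R) :
    ∑ A : Set E, (if A.ncard = 1 then c else 0) = Nat.card E * c := by
  classical
  have := Fintype.ofFinite E
  rw [← Finset.sum_filter, Finset.sum_const, nsmul_eq_mul]
  congr 2
  have h : (Finset.univ.filter fun A : Set E => A.ncard = 1) =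
      Finset.univ.image fun e : E => ({e} : Set E) := by
    ext A
    simp only [Finset.mem_filter, Finset.mem_univ, true_and, Finset.mem_image, Set.ncard_eq_one]
    exact exists_congr fun _ => eq_comm
  rw [h, Finset.card_image_of_injective _ Set.singleton_injective, Finset.card_univ,
    Nat.card_eq_fintype_card]

/-- Each ordering of the edges contributes the weight once. In the induction the first edge is split
off: there are `m + 1` choices, each followed by `m!` orderings of the rest. -/
theorem convPow_selector {a : Fin 4 → R} (ha : a 2 ^ 2 = a 1 * a 3) (m : ℕ) (G : VPRibbonGraph) :
    (WithConv.toConv (selector (K := K) a) ^ m).ofConv (of K G) =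
      if G.numEdges = m then (m.factorial : R) * G.weight a else 0 := by
  induction m generalizing G with
  | zero =>
    rw [pow_zero, LinearMap.convOne_apply, counit_of]
    change algebraMap K R (if G.numEdges = 0 then 1 else 0) = _
    split_ifs with h
    · simp [G.weight_of_numEdges_eq_zero a h]
    · simp
  | succ m ih =>
    rw [pow_succ']
    refine (conv_of (selector a) (WithConv.toConv (selector (K := K) a) ^ m).ofConv G).trans ?_
    -- Only singletons `A` contribute, and by multiplicativity of the weight the summand is the same
    -- for all of them.
    have h (A : Set G.Edge) : selector a (of K (G.delete Aᶜ)) *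
        (WithConv.toConv (selector (K := K) a) ^ m).ofConv (of K (G.contract A)) =
          if A.ncard = 1 then
            (if G.numEdges = m + 1 then (m.factorial : R) * G.weight a else 0) else 0 := by
      rw [selector_of, ih, numEdges_delete_compl]
      have h1 := G.numEdges_contract A
      by_cases hA : A.ncard = 1
      · rw [if_pos hA, if_pos hA]
        by_cases hG : G.numEdges = m + 1
        · rw [if_pos hG, if_pos (by omega), ← G.weight_mul ha A]
          ring
        · rw [if_neg hG, if_neg (by omega), mul_zero]
      · rw [if_neg hA, if_neg hA, zero_mul]
    rw [Finset.sum_congr rfl fun A _ => h A, sum_ncard_eq_one]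
    change (G.numEdges : R) * _ = _
    split_ifs with hG
    · rw [hG, Nat.factorial_succ]
      push_cast
      ring
    · rw [mul_zero]

variable [Algebra ℚ R]

/-- Only the term with `m` equal to the number of edges survives, and its factorial cancels. -/
theorem convExp_selector {a : Fin 4 → R} (ha : a 2 ^ 2 = a 1 * a 3) (G : VPRibbonGraph) :
    convExp (selector (K := K) a) (of K G) = G.weight a := by
  have h : convExp (selector (K := K) a) (of K G) = ∑ᶠ m : ℕ, (1 / (m.factorial : ℚ)) •
      (WithConv.toConv (selector (K := K) a) ^ m).ofConv (of K G) :=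
    (basis K).constr_basis K _ _
  rw [h, finsum_eq_single _ G.numEdges]
  · rw [convPow_selector ha, if_pos rfl, ← nsmul_eq_mul, ← Nat.cast_smul_eq_nsmul ℚ, smul_smul,
      one_div, inv_mul_cancel₀ (Nat.cast_ne_zero.2 (Nat.factorial_ne_zero _)), one_smul]
  · intro m hm
    rw [convPow_selector ha, if_neg hm.symm, smul_zero]

theorem tutte_of {a b : Fin 4 → R} (ha : a 2 ^ 2 = a 1 * a 3) (hb : b 2 ^ 2 = b 1 * b 3)
    (G : VPRibbonGraph) : tutte a b (of K G) =
      ∑ A : Set G.Edge, (G.delete Aᶜ).weight a * (G.contract A).weight b := by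
  rw [tutte, conv_of]
  exact Finset.sum_congr rfl fun A _ => by rw [convExp_selector ha, convExp_selector hb]

end Hvrg

/-! ### Half-integer powers, the Bollobás–Riordan sum and the comparison of exponents -/

theorem halfPow_eq {R : Type*} [CommRing R] (s : Rˣ) {q : ℚ} {n : ℤ} (h : 2 * q = n) :
    halfPow s q = s ^ n := by
  rw [halfPow, h, Rat.num_intCast]

theorem sqrt_selector_condition {R : Type*} [CommRing R] (x s t : Rˣ) :
    (![(x : R), s ^ 2, s * t, t ^ 2] : Fin 4 → R) 2 ^ 2 =
      (![(x : R), s ^ 2, s * t, t ^ 2] : Fin 4 → R) 1 *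
        (![(x : R), s ^ 2, s * t, t ^ 2] : Fin 4 → R) 3 := by
  simp only [Matrix.cons_val]
  ring

/-- By additivity of the rank, `r(G) - r(A)` is the block rank of the contraction, so every exponent
becomes an invariant of one of the two tensor factors of the coproduct. -/
theorem bollobasRiordan_eq {R : Type*} [CommRing R] (G : RibbonGraph) (x y z : R) :
    bollobasRiordan G x y z = ∑ A : Set G.discrete.Edge,
      (x - 1) ^ (G.discrete.contract A).blockRank * y ^ (G.discrete.delete Aᶜ).nullity *
        z ^ (G.discrete.delete Aᶜ).excess := by
  refine Finset.sum_congr rfl fun (A : Set G.Edge) _ => ?_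
  -- Deletion leaves the vertices unchanged, so it commutes definitionally with passing to the
  -- singleton partition.
  have h1 : G.rank = (G.delete Aᶜ).rank + (G.discrete.contract A).blockRank :=
    (G.discrete.blockRank_add A).symm
  have h2 : A.ncard - (G.delete Aᶜ).rank = (G.discrete.delete Aᶜ).nullity :=
    congrArg (· - (G.delete Aᶜ).rank) (G.discrete.numEdges_delete_compl A).symm
  have h3 : (G.delete Aᶜ).eulerGenus = (G.discrete.delete Aᶜ).excess :=
    (G.delete Aᶜ).eulerGenus_eq
  rw [h2, h3, h1, Nat.add_sub_cancel_left]

theorem theorem3p22 {K : Type*} [CommRing K] {R : Type*} [CommRing R] [Algebra K R] [Algebra ℚ R] :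
    -- the selectors with `a₃ = √(a₂ a₄)` are uniform
    (∀ a : Fin 4 → R, a 2 ^ 2 = a 1 * a 3 → Hvrg.IsUniform (Hvrg.selector (K := K) a)) ∧
    -- the state sum, with `x₂ = s₂²`, `x₃ = s₃²`, `y₂ = t₂²`, `y₃ = t₃²`
    (∀ (x₁ s₂ s₃ y₁ t₂ t₃ : Rˣ) (G : VPRibbonGraph),
      Hvrg.tutte (K := K) ![(x₁ : R), s₂ ^ 2, s₂ * s₃, s₃ ^ 2] ![(y₁ : R), t₂ ^ 2, t₂ * t₃, t₃ ^ 2]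
          (Hvrg.of K G) =
        ((y₁ ^ G.blockRank * halfPow t₂ (G.numEdges - G.rho) * halfPow t₃ (G.rho - G.blockRank) :
            Rˣ) : R) *
          ∑ A : Set G.Edge,
            (((x₁ / y₁) ^ (G.delete Aᶜ).blockRank *
              halfPow (s₂ / t₂) (A.ncard - (G.delete Aᶜ).rho) *
              halfPow (s₃ / t₃) ((G.delete Aᶜ).rho - (G.delete Aᶜ).blockRank) : Rˣ) : R)) ∧
    -- the Bollobás–Riordan polynomial, for the partition into singletons
    (∀ (x₁ s₂ s₃ y₁ t₂ t₃ : Rˣ) (G : RibbonGraph),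
      Hvrg.tutte (K := K) ![(x₁ : R), s₂ ^ 2, s₂ * s₃, s₃ ^ 2] ![(y₁ : R), t₂ ^ 2, t₂ * t₃, t₃ ^ 2]
          (Hvrg.of K G.discrete) =
        ((x₁ ^ G.rank * (t₂ ^ 2) ^ ((G.numEdges : ℤ) - G.rank) * (t₃ / t₂) ^ G.eulerGenus : Rˣ) : R) *
          bollobasRiordan G ((y₁ / x₁ : Rˣ) + 1 : R) ((s₂ ^ 2 / t₂ ^ 2 : Rˣ) : R)
            ((s₃ * t₂ / (s₂ * t₃) : Rˣ) : R)) ∧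
    (∀ (x y z : R) (G : RibbonGraph),
      Hvrg.tutte (K := K) ![1, y, y * z, y * z ^ 2] ![x - 1, 1, 1, 1] (Hvrg.of K G.discrete) =
        bollobasRiordan G x y z) := by
  refine ⟨fun a ha G m σ τ => ?_, fun x₁ s₂ s₃ y₁ t₂ t₃ G => ?_, fun x₁ s₂ s₃ y₁ t₂ t₃ G => ?_,
    fun x y z G => ?_⟩
  · rw [Hvrg.prod_selector_factor G σ ha, Hvrg.prod_selector_factor G τ ha]
  · rw [Hvrg.tutte_of (sqrt_selector_condition _ _ _) (sqrt_selector_condition _ _ _),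
      Finset.mul_sum]
    refine Finset.sum_congr rfl fun A _ => ?_
    have hA : 2 * ((A.ncard : ℚ) - (G.delete Aᶜ).rho) =
        ((2 * (G.delete Aᶜ).nullity - (G.delete Aᶜ).excess : ℤ) : ℚ) := by
      rw [← VPRibbonGraph.two_mul_sub_rho, VPRibbonGraph.numEdges_delete_compl]
    rw [VPRibbonGraph.weight, VPRibbonGraph.weight,
      monomialWeight_units _ _ _ (VPRibbonGraph.excess_le _),
      monomialWeight_units _ _ _ (VPRibbonGraph.excess_le _), halfPow_eq _ G.two_mul_sub_rho,
      halfPow_eq _ G.two_mul_rho_sub, halfPow_eq _ hA,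
      halfPow_eq _ (G.delete Aᶜ).two_mul_rho_sub, ← G.blockRank_add A, ← G.nullity_add A,
      ← G.excess_add A, ← Units.val_mul, ← Units.val_mul]
    congr 1
    -- Written additively, an identity between monomials in units is a linear identity in a
    -- `ℤ`-module.
    apply Additive.ofMul.injective
    simp only [ofMul_mul, ofMul_zpow, ofMul_div, ofMul_pow]
    push_cast
    module
  · rw [Hvrg.tutte_of (sqrt_selector_condition _ _ _) (sqrt_selector_condition _ _ _),
      bollobasRiordan_eq, Finset.mul_sum]
    refine Finset.sum_congr rfl fun A _ => ?_
    have h1 : G.rank = (G.discrete.delete Aᶜ).blockRank + (G.discrete.contract A).blockRank :=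
      (G.discrete.blockRank_add A).symm
    have h4 : ((G.numEdges : ℤ) - G.rank) =
        (G.discrete.delete Aᶜ).nullity + (G.discrete.contract A).nullity := by
      rw [← Nat.cast_add, G.discrete.nullity_add A, VPRibbonGraph.nullity_cast,
        ← VPRibbonGraph.blockRank_eq]
      rfl
    rw [VPRibbonGraph.weight, VPRibbonGraph.weight,
      monomialWeight_units _ _ _ (VPRibbonGraph.excess_le _),
      monomialWeight_units _ _ _ (VPRibbonGraph.excess_le _), h4, h1, add_sub_cancel_right, G.eulerGenus_eq,
      ← G.discrete.excess_add A]
    simp only [← Units.val_pow_eq_pow_val, ← Units.val_mul]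
    congr 1
    apply Additive.ofMul.injective
    simp only [ofMul_mul, ofMul_zpow, ofMul_div, ofMul_pow]
    module
  · have ha : (![1, y, y * z, y * z ^ 2] : Fin 4 → R) 2 ^ 2 =
        (![1, y, y * z, y * z ^ 2] : Fin 4 → R) 1 * (![1, y, y * z, y * z ^ 2] : Fin 4 → R) 3 := by
      simp only [Matrix.cons_val]
      ring
    have hb : (![x - 1, 1, 1, 1] : Fin 4 → R) 2 ^ 2 =
        (![x - 1, 1, 1, 1] : Fin 4 → R) 1 * (![x - 1, 1, 1, 1] : Fin 4 → R) 3 := by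
      simp only [Matrix.cons_val]
      ring
    rw [Hvrg.tutte_of ha hb, bollobasRiordan_eq]
    refine Finset.sum_congr rfl fun A _ => ?_
    -- Here `y` and `z` need not be units. In the normal form `y ^ j * (y * z) ^ c * (y * z ^ 2) ^
    -- k` collects to `y ^ (k + c + j) * z ^ (2 * k + c)`, while the second weight reduces to a
    -- power of `x - 1`.
    obtain ⟨k, c, j, hc, hN, hM⟩ :=
      exists_weight_decomposition (G.discrete.delete Aᶜ).excess_le
    rw [VPRibbonGraph.weight, VPRibbonGraph.weight, hN,
      hM, monomialWeight_eq _ _ _ _ _ hc, monomialWeight]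
    simp only [Matrix.cons_val, one_pow, mul_one]
    ring
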